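/- Let $\Bbbk$ be an algebraically closed field of characteristic zero, let $t,a,b,p\in\Bbbk$ with $t\neq 0$, and let $V$ be the vector space with basis $x_1,x_2,x_3$ and with the braiding $c$ (associated to the $R$-matrix $\mathfrak{R}_{1,4}$) given by $$\begin{aligned} c(x_i\otimes x_i)&=t\,x_i\otimes x_i\ (i=1,2), \qquad c(x_1\otimes x_2)=t\,x_2\otimes x_1,\qquad c(x_2\otimes x_1)=t\,x_1\otimes x_2,\\ c(x_1\otimes x_3)&=t\,x_3\otimes x_1-ta\,x_1\otimes x_1,\qquad c(x_3\otimes x_1)=t\,x_1\otimes x_3+ta\,x_1\otimes x_1,\\ c(x_2\otimes x_3)&=t\,x_3\otimes x_2+t(a-2b)\,x_1\otimes x_2,\qquad c(x_3\otimes x_2)=t\,x_2\otimes x_3+t(2b-a)\,x_2\otimes x_1,\\ c(x_3\otimes x_3)&=t\,x_3\otimes x_3+tb\,x_3\otimes x_1-tb\,x_1\otimes x_3+tp\,x_1\otimes x_2-tab\,x_1\otimes x_1 . \end{aligned}$$ Let $\mathcal{J}(V)$ be the largest homogeneous Hopf ideal of the braided Hopf algebra $T(V)$ that is generated by elements of degree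 $\geq 2$, and let $\mathfrak{B}(V)=T(V)/\mathcal{J}(V)$ be the Nichols algebra of $V$. Write $\mathcal{J}_2(V)$ for the component of $\mathcal{J}(V)$ in degree 2, and $\operatorname{GKdim}$ for the Gelfand–Kirillov dimension. Then: 1. If $t^2\neq 1$, then $\mathfrak{B}(V)$ has no quadratic relations, that is, $\mathcal{J}_2(V)=0$. 2. If $t=1$, then $$\mathcal{J}(V)=\langle x_2x_1-x_1x_2,\ x_3x_1-x_1x_3-a\,x_1^2,\ x_3x_2-x_2x_3+(a-2b)\,x_1x_2\rangle,$$ the monomials $x_1^{a_1}x_2^{a_2}x_3^{a_3}$ with $a_i\geq 0$ form a basis of $\mathfrak{B}(V)$, and $\operatorname{GKdim}\mathfrak{B}(V)=3$. 3. If $t=-1$ and $p\neq 0$, then $$\mathcal{J}(V)=\langle x_2x_1+x_1x_2,\ x_3x_1+x_1x_3,\ x_3x_2+x_2x_3+(a-2b)\,x_1x_2,\ x_1^2,\ x_2^2\rangle,$$ the monomials $x_1^{a_1}x_2^{a_2}x_3^{a_3}$ with $0\leq a_1,a_2<2$ and $a_3\geq 0$ form a basis of $\mathfrak{B}(V)$,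 and $\operatorname{GKdim}\mathfrak{B}(V)=1$. 4. If $t=-1$ and $p=0$, then $$\mathcal{J}(V)=\langle x_2x_1+x_1x_2,\ x_3x_1+x_1x_3,\ x_3x_2+x_2x_3+(a-2b)\,x_1x_2,\ x_1^2,\ x_2^2,\ x_3^2-b\,x_1x_3\rangle,$$ the monomials $x_1^{a_1}x_2^{a_2}x_3^{a_3}$ with $0\leq a_i<2$ form a basis of $\mathfrak{B}(V)$, $\operatorname{GKdim}\mathfrak{B}(V)=0$, and $\dim\mathfrak{B}(V)=8$. -/

import Mathlib

open scoped TensorProduct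

namespace BraidedRank

/-- A braided vector space `(V, c)` with a chosen finite basis `(x_i)`, `i : ι`, where
`c (x_i ⊗ x_j) = ∑ l m, coeff i j l m • (x_l ⊗ x_m)`.
`inv_coeff` and `coeff_inv` say that `c` is invertible on `V ⊗ V` (with inverse given by `inv`);
`braid` is the braid equation
`(c ⊗ id)(id ⊗ c)(c ⊗ id) = (id ⊗ c)(c ⊗ id)(id ⊗ c)`, read off on the coefficient of
`x_d ⊗ x_e ⊗ x_f` in the image of `x_i ⊗ x_j ⊗ x_l`. -/
structure Braiding (k ι : Type*) [Field k] [Fintype ι] [DecidableEq ι] where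
  coeff : ι → ι → ι → ι → k
  inv : ι → ι → ι → ι → k
  coeff_inv : ∀ i j d e : ι,
    ∑ u, ∑ v, coeff i j u v * inv u v d e = if i = d ∧ j = e then 1 else 0
  inv_coeff : ∀ i j d e : ι,
    ∑ u, ∑ v, inv i j u v * coeff u v d e = if i = d ∧ j = e then 1 else 0
  braid : ∀ i j l d e f : ι,
    ∑ u, ∑ v, coeff i j u v * ∑ w, coeff v l w f * coeff u w d e =
      ∑ u, ∑ v, coeff j l u v * ∑ w, coeff i u d w * coeff w v e f

section Nichols

variable {k ι : Type*} [Field k] [Fintype ι] [DecidableEq ι]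

/-- The tensor algebra `T(V)`, for `V` with basis indexed by `ι`: noncommutative polynomials. -/
abbrev T (k ι : Type*) [Field k] : Type _ := FreeAlgebra k ι

/-- The homogeneous component `T^n(V)`, spanned by the words of length `n`. -/
def deg (k ι : Type*) [Field k] (n : ℕ) : Submodule k (T k ι) :=
  Submodule.span k {w | ∃ l : List ι, l.length = n ∧ w = (l.map (FreeAlgebra.ι k)).prod}

/-- The extension of `c` to `V ⊗ T(V) → T(V) ⊗ V`, written as
`c (x_i ⊗ u) = ∑ j, (extend B u) i j ⊗ x_j`. The compatibility of `c` with the multiplication,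
`c (x_i ⊗ u u') = ∑ j, (extend B u) i j • c (x_j ⊗ u')`, says precisely that `extend B` is
an algebra map to matrices over `T(V)`. -/
noncomputable def extend (B : Braiding k ι) : T k ι →ₐ[k] Matrix ι ι (T k ι) :=
  FreeAlgebra.lift k fun m => Matrix.of fun i j => ∑ l, B.coeff i m l j • FreeAlgebra.ι k l

/-- The linear map `u ↦ (extend B u) i j` from `T(V)` to `T(V)`. -/
noncomputable def extendEntry (B : Braiding k ι) (i j : ι) : T k ι →ₗ[k] T k ι :=
  Matrix.entryLinearMap k (T k ι) i j ∘ₗ (extend B).toLinearMap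

/-- Left multiplication by `x_i ⊗ 1 + 1 ⊗ x_i` in the braided tensor product algebra
`T(V) ⊗ T(V)`, whose product is `(u ⊗ v)(u' ⊗ v') = u c(v ⊗ u') v'`. Thus `u ⊗ v` goes to
`x_i u ⊗ v + ∑ j, (extend B u) i j ⊗ x_j v`. -/
noncomputable def primitiveMul (B : Braiding k ι) (i : ι) :
    T k ι ⊗[k] T k ι →ₗ[k] T k ι ⊗[k] T k ι :=
  TensorProduct.map (LinearMap.mulLeft k (FreeAlgebra.ι k i)) LinearMap.id +
    ∑ j, TensorProduct.map (extendEntry B i j) (LinearMap.mulLeft k (FreeAlgebra.ι k j))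

/-- The comultiplication of the braided Hopf algebra `T(V)`: the algebra map from `T(V)` to the
braided tensor product `T(V) ⊗ T(V)` with `x_i ↦ x_i ⊗ 1 + 1 ⊗ x_i`. -/
noncomputable def comul (B : Braiding k ι) : T k ι →ₗ[k] T k ι ⊗[k] T k ι :=
  LinearMap.applyₗ (1 ⊗ₜ[k] 1) ∘ₗ
    (FreeAlgebra.lift k (A := Module.End k (T k ι ⊗[k] T k ι)) (primitiveMul B)).toLinearMap

/-- The underlying subspace of a two-sided ideal of `T(V)`. -/
def toSub (I : TwoSidedIdeal (T k ι)) : Submodule k (T k ι) :=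
  (TwoSidedIdeal.asIdeal I).restrictScalars k

/-- The subspace `I ⊗ T(V) + T(V) ⊗ I` of `T(V) ⊗ T(V)`. -/
def coidealSub (I : TwoSidedIdeal (T k ι)) : Submodule k (T k ι ⊗[k] T k ι) :=
  Submodule.span k {z | ∃ u v : T k ι, (u ∈ I ∨ v ∈ I) ∧ z = u ⊗ₜ[k] v}

/-- Homogeneous Hopf ideals of `T(V)` generated in degrees at least two. The counit vanishes on
such an ideal for degree reasons, and the ideal is stable under the antipode because `T(V)` is
graded and connected. -/
structure IsHopfIdeal (B : Braiding k ι) (I : TwoSidedIdeal (T k ι)) : Prop where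
  homogeneous : toSub I ≤ ⨆ n ≥ 2, toSub I ⊓ deg k ι n
  coideal : ∀ u ∈ I, comul B u ∈ coidealSub I

/-- The ideal `J(V)` of relations of the Nichols algebra: the largest homogeneous Hopf ideal of
`T(V)` in degrees at least two. No stability under `c` is demanded of the ideals here: the
largest one, which is the direct sum of the kernels of the quantum symmetrizers, is stable under
`c` anyway, so demanding it would give the same ideal. -/
def nicholsIdeal (B : Braiding k ι) : TwoSidedIdeal (T k ι) :=
  sSup {I | IsHopfIdeal B I}

/-- The largest homogeneous Hopf ideal exists. -/
theorem nicholsIdeal_isGreatest (B : Braiding k ι) :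
    IsGreatest {I | IsHopfIdeal B I} (nicholsIdeal B) := by
  refine ⟨?_, fun I hI => le_sSup hI⟩
  set S : Submodule k (T k ι) := ⨆ I ∈ {I | IsHopfIdeal B I}, toSub I with hS
  have hle : ∀ I, IsHopfIdeal B I → toSub I ≤ S := fun I hI =>
    le_iSup₂_of_le (f := fun I (_ : I ∈ {I | IsHopfIdeal B I}) => toSub I) I hI le_rfl
  have hmulL : ∀ x y, y ∈ S → x * y ∈ S := by
    intro x y hy
    have : S ≤ S.comap (LinearMap.mulLeft k x) :=
      iSup₂_le fun I hI z hz => hle I hI (I.mul_mem_left x z hz)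
    exact this hy
  have hmulR : ∀ x y, x ∈ S → x * y ∈ S := by
    intro x y hx
    have : S ≤ S.comap (LinearMap.mulRight k y) :=
      iSup₂_le fun I hI z hz => hle I hI (I.mul_mem_right z y hz)
    exact this hx
  let J : TwoSidedIdeal (T k ι) := TwoSidedIdeal.mk' (S : Set (T k ι)) S.zero_mem
    S.add_mem S.neg_mem (fun {x y} h => hmulL x y h) (fun {x y} h => hmulR x y h)
  have hJ : ∀ x, x ∈ J ↔ x ∈ S := fun x => by simp [J]
  have hJN : nicholsIdeal B ≤ J :=
    sSup_le fun I hI x hx => (hJ x).2 (hle I hI hx)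
  have hNS : toSub (nicholsIdeal B) ≤ S := fun x hx => (hJ x).1 (hJN hx)
  have hIN : ∀ I, IsHopfIdeal B I → I ≤ nicholsIdeal B := fun I hI => le_sSup hI
  refine ⟨hNS.trans (iSup₂_le fun I hI => hI.homogeneous.trans ?_), fun u hu => ?_⟩
  · exact iSup₂_mono fun n _ => inf_le_inf_right _ fun x hx => hIN I hI hx
  · have : S ≤ (coidealSub (nicholsIdeal B)).comap (comul B) := by
      refine iSup₂_le fun I hI x hx => ?_
      refine Submodule.span_mono ?_ (hI.coideal x hx)
      rintro z ⟨u, v, h, rfl⟩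
      exact ⟨u, v, h.imp (fun h => hIN I hI h) (fun h => hIN I hI h), rfl⟩
    exact this (hNS hu)

/-- The Nichols algebra `T(V) / J(V)`. -/
abbrev NicholsAlgebra (B : Braiding k ι) : Type _ := (nicholsIdeal B).ringCon.Quotient

/-- The quadratic relations of the Nichols algebra, `J_2(V) = J(V) ∩ T^2(V)`. -/
def quadraticRelations (B : Braiding k ι) : Submodule k (T k ι) :=
  toSub (nicholsIdeal B) ⊓ deg k ι 2

end Nichols

/-- The monomials `x_1^{e_1} x_2^{e_2} x_3^{e_3}`, for exponents `e` in `S`, form a basis of the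
Nichols algebra of a braided vector space of dimension three. -/
def IsMonomialBasis {k : Type*} [Field k] (B : Braiding k (Fin 3)) (S : Set (Fin 3 → ℕ)) : Prop :=
  let x : Fin 3 → NicholsAlgebra B := fun i =>
    (nicholsIdeal B).ringCon.mk' (FreeAlgebra.ι k i)
  let v : S → NicholsAlgebra B := fun e => x 0 ^ e.1 0 * x 1 ^ e.1 1 * x 2 ^ e.1 2
  LinearIndependent k v ∧ Submodule.span k (Set.range v) = ⊤

/-- Exponents of `B_0`. -/
def B₀ : Set (Fin 3 → ℕ) := {e | ∀ i, e i < 2}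

/-- Exponents of `B_1`. -/
def B₁ : Set (Fin 3 → ℕ) := {e | e 0 < 2 ∧ e 1 < 2}

/-- Exponents of `B_3`. -/
def B₃ : Set (Fin 3 → ℕ) := Set.univ

/-- The Gelfand--Kirillov dimension of a `k`-algebra: the supremum over its finite-dimensional
subspaces `W` of `limsup_n log (dim (k + W)^n) / log n`, where `(k + W)^n = k + W + ⋯ + W^n`. -/
noncomputable def gkDim (k A : Type*) [Field k] [Ring A] [Algebra k A] : EReal :=
  ⨆ W : {W : Submodule k A // W.FG}, Filter.limsup (fun n : ℕ =>
    ((Real.log (Module.finrank k ((1 ⊔ W.1) ^ n : Submodule k A)) / Real.log n : ℝ) : EReal))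
    Filter.atTop

section R14

variable {k : Type*} [Field k]

/-- The `R`-matrix `R_{1,4}`. Rows are indexed by `11, 12, 13, 21, 22, 23, 31, 32, 33` and
columns by `11, 21, 31, 12, 22, 32, 13, 23, 33`. -/
def R14 (t a b p : k) : Matrix (Fin 9) (Fin 9) k :=
  !![t, 0, t * a, 0, 0, 0, -(t * a), 0, -(t * a * b);
     0, t, 0, 0, 0, 0, 0, t * (a - 2 * b), t * p;
     0, 0, t, 0, 0, 0, 0, 0, -(t * b);
     0, 0, 0, t, 0, t * (2 * b - a), 0, 0, 0;
     0, 0, 0, 0, t, 0, 0, 0, 0;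
     0, 0, 0, 0, 0, t, 0, 0, 0;
     0, 0, 0, 0, 0, 0, t, 0, t * b;
     0, 0, 0, 0, 0, 0, 0, t, 0;
     0, 0, 0, 0, 0, 0, 0, 0, t]

/-- The entry `r^{ij}_{lm}`, in the row `lm` and the column `ij`
(`finProdFinEquiv (u, v)` is `3 u + v`). -/
def r14 (t a b p : k) (i j l m : Fin 3) : k :=
  R14 t a b p (finProdFinEquiv (l, m)) (finProdFinEquiv (j, i))

/-- The matrix of the inverse braiding, with the same labels of rows and columns. -/
def R14Inv (t a b p : k) : Matrix (Fin 9) (Fin 9) k :=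
  !![t⁻¹, 0, t⁻¹ * a, 0, 0, 0, -(t⁻¹ * a), 0, -(t⁻¹ * a * b);
     0, t⁻¹, 0, 0, 0, 0, 0, t⁻¹ * (a - 2 * b), 0;
     0, 0, t⁻¹, 0, 0, 0, 0, 0, -(t⁻¹ * b);
     0, 0, 0, t⁻¹, 0, t⁻¹ * (2 * b - a), 0, 0, -(t⁻¹ * p);
     0, 0, 0, 0, t⁻¹, 0, 0, 0, 0;
     0, 0, 0, 0, 0, t⁻¹, 0, 0, 0;
     0, 0, 0, 0, 0, 0, t⁻¹, 0, t⁻¹ * b;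
     0, 0, 0, 0, 0, 0, 0, t⁻¹, 0;
     0, 0, 0, 0, 0, 0, 0, 0, t⁻¹]

def r14Inv (t a b p : k) (i j l m : Fin 3) : k :=
  R14Inv t a b p (finProdFinEquiv (l, m)) (finProdFinEquiv (j, i))

/-- The value of the braiding `x_i ⊗ x_j ↦ ∑ r^{ij}_{uv} x_u ⊗ x_v`, tested on `g`. -/
theorem r14_sum (t a b p : k) (i j : Fin 3) (g : Fin 3 → Fin 3 → k) :
    ∑ u, ∑ v, r14 t a b p i j u v * g u v = t * (g j i +
      (if i = 2 ∧ j = 0 then a * g 0 0 else 0) - (if i = 0 ∧ j = 2 then a * g 0 0 else 0) +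
      (if i = 2 ∧ j = 1 then (2 * b - a) * g 1 0 else 0) -
      (if i = 1 ∧ j = 2 then (2 * b - a) * g 0 1 else 0) +
      (if i = 2 ∧ j = 2 then b * g 2 0 - b * g 0 2 + p * g 0 1 - a * b * g 0 0 else 0)) := by
  fin_cases i <;> fin_cases j <;>
    simp [r14, R14, Fin.sum_univ_three, finProdFinEquiv] <;> ring

theorem r14Inv_sum (t a b p : k) (i j : Fin 3) (g : Fin 3 → Fin 3 → k) :
    ∑ u, ∑ v, r14Inv t a b p i j u v * g u v = t⁻¹ * (g j i +
      (if i = 2 ∧ j = 0 then a * g 0 0 else 0) - (if i = 0 ∧ j = 2 then a * g 0 0 else 0) +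
      (if i = 2 ∧ j = 1 then (2 * b - a) * g 1 0 else 0) -
      (if i = 1 ∧ j = 2 then (2 * b - a) * g 0 1 else 0) +
      (if i = 2 ∧ j = 2 then b * g 2 0 - b * g 0 2 - p * g 1 0 - a * b * g 0 0 else 0)) := by
  fin_cases i <;> fin_cases j <;>
    simp [r14Inv, R14Inv, Fin.sum_univ_three, finProdFinEquiv] <;> ring

theorem r14_braid_aux (t a b p : k) (i j l : Fin 3) (g : Fin 3 → Fin 3 → Fin 3 → k) :
    ∑ u, ∑ v, r14 t a b p i j u v * ∑ w, ∑ f, r14 t a b p v l w f *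
        ∑ d, ∑ e, r14 t a b p u w d e * g d e f =
      ∑ u, ∑ v, r14 t a b p j l u v * ∑ d, ∑ w, r14 t a b p i u d w *
        ∑ e, ∑ f, r14 t a b p w v e f * g d e f := by
  simp only [r14_sum]
  fin_cases i <;> fin_cases j <;> fin_cases l <;>
    simp [-mul_eq_mul_left_iff] <;> ring

/-- The braided vector space attached to `R_{1,4}`, with
`c (x_i ⊗ x_j) = ∑ l m, r^{ij}_{lm} x_l ⊗ x_m`. -/
def braiding14 (t a b p : k) (ht : t ≠ 0) : Braiding k (Fin 3) where
  coeff := r14 t a b p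
  inv := r14Inv t a b p
  coeff_inv i j d e := by
    have h := r14_sum t a b p i j (fun u v => r14Inv t a b p u v d e)
    rw [h]
    fin_cases i <;> fin_cases j <;> fin_cases d <;> fin_cases e <;>
      simp [r14Inv, R14Inv, finProdFinEquiv, ht] <;> ring
  inv_coeff i j d e := by
    have h := r14Inv_sum t a b p i j (fun u v => r14 t a b p u v d e)
    rw [h]
    fin_cases i <;> fin_cases j <;> fin_cases d <;> fin_cases e <;>
      simp [r14, R14, finProdFinEquiv, ht] <;> field_simp <;> ring
  braid i j l d e f := by
    have h := r14_braid_aux t a b p i j l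
      (fun d' e' f' => if d' = d then if e' = e then if f' = f then 1 else 0 else 0 else 0)
    simpa using h

end R14

end BraidedRank

/-!
A quadratic element in the kernel of `1 + c` is primitive, and the ideal generated by all of these
is a Hopf ideal; this puts the relations into `𝒥(V)`. Modulo the relations every word is a
combination of ordered monomials `x₁^e₁ x₂^e₂ x₃^e₃`.

Conversely, `𝒥(V)` is stable under the skew derivations `∂ᵢ`, defined by `Δ u = ∑ xᵢ ⊗ ∂ᵢ u + ⋯`,
and it is killed by the counit `ε` and by the linear coefficients. Hence its part of degree two is
the kernel of `1 + c`, and a functional `ε ∂₁^e₁ Ψ ∂₂^e₂` with `Ψ` composed of skew derivations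
descends to the Nichols algebra. If `Ψ` is chosen to detect `x₃^e₃`, then these functionals are
triangular on the ordered monomials, which are therefore linearly independent. One can take
`Ψ = ∂₃^e₃` unless `t = -1` and `p ≠ 0`. In this case `∂₃²` kills `x₃²`, but `∂₂ ∂₁ x₃²` is a
nonzero multiple of `p`, and powers of `∂₂ ∂₁` detect the even powers of `x₃`.

The Gelfand–Kirillov dimension then counts the exponents of bounded total degree.
-/

namespace BraidedRank

section TensorAlgebra

variable {k ι : Type*} [Field k]

theorem T_induction {p : T k ι → Prop} (one : p 1)
    (mul : ∀ i u, p u → p (FreeAlgebra.ι k i * u))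
    (add : ∀ u v, p u → p v → p (u + v)) (smul : ∀ (r : k) u, p u → p (r • u)) (u : T k ι) :
    p u := by
  have mul_left : ∀ v, p v → p (u * v) := by
    induction u using FreeAlgebra.induction with
    | grade0 r => exact fun v hv => Algebra.smul_def r v ▸ smul r v hv
    | grade1 i => exact mul i
    | mul a b ha hb => exact fun v hv => mul_assoc a b v ▸ ha _ (hb v hv)
    | add a b ha hb => exact fun v hv => add_mul a b v ▸ add _ _ (ha v hv) (hb v hv)
  exact mul_one u ▸ mul_left 1 one

theorem mem_toSub {I : TwoSidedIdeal (T k ι)} {u : T k ι} : u ∈ toSub I ↔ u ∈ I :=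
  Iff.rfl

theorem toSub_span_le {S : Set (T k ι)} {P : Submodule k (T k ι)} (hS : S ⊆ P)
    (left : ∀ i, ∀ u ∈ P, FreeAlgebra.ι k i * u ∈ P)
    (right : ∀ i, ∀ u ∈ P, u * FreeAlgebra.ι k i ∈ P) :
    toSub (TwoSidedIdeal.span S) ≤ P := by
  have mul_mem : ∀ a, ∀ u ∈ P, a * u ∈ P ∧ u * a ∈ P := fun a => by
    induction a using FreeAlgebra.induction with
    | grade0 r =>
      intro u hu
      rw [← Algebra.commutes, ← Algebra.smul_def]
      exact ⟨P.smul_mem r hu, P.smul_mem r hu⟩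
    | grade1 i => exact fun u hu => ⟨left i u hu, right i u hu⟩
    | mul a b ha hb =>
      exact fun u hu => ⟨mul_assoc a b u ▸ (ha _ (hb u hu).1).1,
        mul_assoc u a b ▸ (hb _ (ha u hu).2).2⟩
    | add a b ha hb =>
      exact fun u hu => ⟨add_mul a b u ▸ add_mem (ha u hu).1 (hb u hu).1,
        mul_add u a b ▸ add_mem (ha u hu).2 (hb u hu).2⟩
  exact fun u hu => TwoSidedIdeal.span_induction (p := fun u _ => u ∈ P) (fun _ h => hS h)
    P.zero_mem (fun _ _ _ _ => P.add_mem) (fun _ _ => P.neg_mem)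
    (fun a x _ hx => (mul_mem a x hx).1) (fun a x _ hx => (mul_mem a x hx).2) hu

theorem mul_mem_deg {m n : ℕ} {u v : T k ι} (hu : u ∈ deg k ι m) (hv : v ∈ deg k ι n) :
    u * v ∈ deg k ι (m + n) := by
  have : deg k ι m * deg k ι n ≤ deg k ι (m + n) := by
    rw [deg, deg, Submodule.span_mul_span, Submodule.span_le]
    rintro _ ⟨_, ⟨l, rfl, rfl⟩, _, ⟨l', rfl, rfl⟩, rfl⟩
    exact Submodule.subset_span
      ⟨l ++ l', List.length_append, by rw [List.map_append, List.prod_append]⟩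
  exact this (Submodule.mul_mem_mul hu hv)

theorem ι_mem_deg (i : ι) : FreeAlgebra.ι k i ∈ deg k ι 1 :=
  Submodule.subset_span ⟨[i], rfl, (List.prod_singleton).symm⟩

theorem span_homogeneous {S : Set (T k ι)} (hS : S ⊆ deg k ι 2) :
    toSub (TwoSidedIdeal.span S) ≤ ⨆ n ≥ 2, toSub (TwoSidedIdeal.span S) ⊓ deg k ι n := by
  set I := TwoSidedIdeal.span S
  have stable : ∀ F : T k ι →ₗ[k] T k ι, (∀ n, ∀ u ∈ toSub I ⊓ deg k ι n,
      F u ∈ toSub I ⊓ deg k ι (n + 1)) → (⨆ n ≥ 2, toSub I ⊓ deg k ι n) ≤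
      (⨆ n ≥ 2, toSub I ⊓ deg k ι n).comap F := fun F hF => iSup₂_le fun n hn u hu =>
    Submodule.mem_iSup_of_mem (n + 1) <|
      Submodule.mem_iSup_of_mem (n.le_succ.trans' hn) (hF n u hu)
  refine toSub_span_le (fun r hr => Submodule.mem_iSup_of_mem 2 <|
    Submodule.mem_iSup_of_mem le_rfl ⟨TwoSidedIdeal.subset_span hr, hS hr⟩) ?_ ?_
  · exact fun i => stable (LinearMap.mulLeft k (FreeAlgebra.ι k i)) fun n u hu =>
      ⟨I.mul_mem_left _ _ hu.1, add_comm 1 n ▸ mul_mem_deg (ι_mem_deg i) hu.2⟩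
  · exact fun i => stable (LinearMap.mulRight k (FreeAlgebra.ι k i)) fun n u hu =>
      ⟨I.mul_mem_right _ _ hu.1, mul_mem_deg hu.2 (ι_mem_deg i)⟩

theorem left_tmul_mem_coidealSub {I : TwoSidedIdeal (T k ι)} {u : T k ι} (hu : u ∈ I)
    (v : T k ι) : u ⊗ₜ[k] v ∈ coidealSub I :=
  Submodule.subset_span ⟨u, v, Or.inl hu, rfl⟩

theorem right_tmul_mem_coidealSub {I : TwoSidedIdeal (T k ι)} {v : T k ι} (hv : v ∈ I)
    (u : T k ι) : u ⊗ₜ[k] v ∈ coidealSub I :=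
  Submodule.subset_span ⟨u, v, Or.inr hv, rfl⟩

theorem map_mem_coidealSub {I : TwoSidedIdeal (T k ι)} {F G : T k ι →ₗ[k] T k ι}
    (hF : ∀ u ∈ I, F u ∈ I) (hG : ∀ u ∈ I, G u ∈ I) {z : T k ι ⊗[k] T k ι}
    (hz : z ∈ coidealSub I) : TensorProduct.map F G z ∈ coidealSub I := by
  have : coidealSub I ≤ (coidealSub I).comap (TensorProduct.map F G) := Submodule.span_le.2 <| by
    rintro _ ⟨u, v, hu | hv, rfl⟩
    · exact left_tmul_mem_coidealSub (hF u hu) _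
    · exact right_tmul_mem_coidealSub (hG v hv) _
  exact this hz

/-- Left multiplication by `x_i ⊗ 1` in the braided tensor product `T(V) ⊗ T(V)`. -/
def mulFst (k : Type*) [Field k] (i : ι) : Module.End k (T k ι ⊗[k] T k ι) :=
  TensorProduct.map (LinearMap.mulLeft k (FreeAlgebra.ι k i)) LinearMap.id

theorem mulFst_tmul (i : ι) (u v : T k ι) :
    mulFst k i (u ⊗ₜ[k] v) = (FreeAlgebra.ι k i * u) ⊗ₜ v := rfl

theorem mulFst_mem_coidealSub {I : TwoSidedIdeal (T k ι)} (i : ι) {z : T k ι ⊗[k] T k ι}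
    (hz : z ∈ coidealSub I) : mulFst k i z ∈ coidealSub I :=
  map_mem_coidealSub (fun u => I.mul_mem_left _ u) (fun _ => id) hz

end TensorAlgebra

section Quadratic

variable {k ι : Type*} [Field k] [Fintype ι]

/-- The quadratic element `∑ f i j • (y i * y j)` in the letters `y` with coefficients `f`. -/
def quad {A : Type*} [Semiring A] [Algebra k A] (y : ι → A) : Matrix ι ι k →ₗ[k] A :=
  ∑ i, ∑ j, (Matrix.entryLinearMap k k i j).smulRight (y i * y j)

theorem quad_apply {A : Type*} [Semiring A] [Algebra k A] (y : ι → A) (f : Matrix ι ι k) :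
    quad y f = ∑ i, ∑ j, f i j • (y i * y j) := by
  simp only [quad, LinearMap.sum_apply, LinearMap.smulRight_apply, Matrix.entryLinearMap_apply]

theorem map_quad {A A' : Type*} [Semiring A] [Algebra k A] [Semiring A'] [Algebra k A']
    (φ : A →ₐ[k] A') (y : ι → A) (f : Matrix ι ι k) : φ (quad y f) = quad (φ ∘ y) f := by
  simp only [quad_apply, map_sum, map_smul, map_mul, Function.comp_apply]

theorem sum_sum_comm {M : Type*} [AddCommMonoid M] (F : ι → ι → ι → ι → M) :
    ∑ i, ∑ j, ∑ l, ∑ m, F i j l m = ∑ l, ∑ m, ∑ i, ∑ j, F i j l m := by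
  calc ∑ i, ∑ j, ∑ l, ∑ m, F i j l m = ∑ i, ∑ l, ∑ m, ∑ j, F i j l m :=
        Finset.sum_congr rfl fun i _ => Finset.sum_comm.trans <|
          Finset.sum_congr rfl fun l _ => Finset.sum_comm
    _ = ∑ l, ∑ m, ∑ i, ∑ j, F i j l m :=
        Finset.sum_comm.trans <| Finset.sum_congr rfl fun l _ => Finset.sum_comm

theorem transpose_mul_mul_apply (α f β : Matrix ι ι k) (d e : ι) :
    (α.transpose * f * β) d e = ∑ i, ∑ j, f i j * (α i d * β j e) := by
  simp only [Matrix.mul_apply, Matrix.transpose_apply, Finset.sum_mul]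
  rw [Finset.sum_comm]
  exact Finset.sum_congr rfl fun i _ => Finset.sum_congr rfl fun j _ => by ring

theorem quad_transpose_mul_mul {A : Type*} [Semiring A] [Algebra k A] (y : ι → A)
    (α f β : Matrix ι ι k) :
    quad y (α.transpose * f * β) =
      ∑ i, ∑ j, f i j • ((∑ d, α i d • y d) * ∑ e, β j e • y e) := by
  simp only [quad_apply, transpose_mul_mul_apply, Finset.sum_smul, Finset.sum_mul_sum,
    Finset.smul_sum, smul_mul_smul_comm, mul_smul]
  exact sum_sum_comm _

theorem quad_mem_deg (f : Matrix ι ι k) : quad (FreeAlgebra.ι k) f ∈ deg k ι 2 := by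
  rw [quad_apply]
  exact sum_mem fun i _ => sum_mem fun j _ =>
    Submodule.smul_mem _ _ (mul_mem_deg (m := 1) (n := 1) (ι_mem_deg i) (ι_mem_deg j))

theorem deg_two_le_range_quad :
    deg k ι 2 ≤ LinearMap.range (quad (k := k) (FreeAlgebra.ι k (X := ι))) := by
  classical
  refine Submodule.span_le.2 ?_
  rintro _ ⟨w, hw, rfl⟩
  obtain ⟨i, j, rfl⟩ := List.length_eq_two.1 hw
  refine ⟨Matrix.single i j 1, ?_⟩
  simp [quad_apply, Matrix.single_apply, ite_and, ite_smul]

theorem quad_mulFst_tmul (f : Matrix ι ι k) (u v : T k ι) :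
    quad (mulFst k) f (u ⊗ₜ[k] v) = (quad (FreeAlgebra.ι k) f * u) ⊗ₜ v := by
  simp only [quad_apply, LinearMap.sum_apply, LinearMap.smul_apply, Module.End.mul_apply,
    mulFst_tmul, Finset.sum_mul, smul_mul_assoc, mul_assoc, TensorProduct.sum_tmul,
    TensorProduct.smul_tmul']

/-- The tensor `∑ f i j • (x_i ⊗ x_j)` is in the kernel of `1 + c`. -/
def InKer [DecidableEq ι] (B : Braiding k ι) (f : Matrix ι ι k) : Prop :=
  ∀ l m, f l m + ∑ i, ∑ j, f i j * B.coeff i j l m = 0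

variable [DecidableEq ι] {B : Braiding k ι} {f : Matrix ι ι k}

theorem InKer.sum_smul_add (hf : InKer B f) {M : Type*} [AddCommMonoid M] [Module k M]
    (G : ι → ι → M) :
    ∑ i, ∑ j, f i j • G i j + ∑ i, ∑ j, f i j • ∑ l, ∑ m, B.coeff i j l m • G l m = 0 := by
  simp only [Finset.smul_sum, smul_smul]
  rw [sum_sum_comm]
  simp only [← Finset.sum_smul, ← Finset.sum_add_distrib, ← add_smul, hf _ _, zero_smul,
    Finset.sum_const_zero]

/-- The coefficients of `f` after the first strand `x_i` has moved past it to become the last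
strand `x_n`: the part in `V ⊗ V` of `(id ⊗ c)(c ⊗ id)(x_i ⊗ f)`. -/
def slideRight (B : Braiding k ι) (i n : ι) (f : Matrix ι ι k) : Matrix ι ι k :=
  ∑ u, (Matrix.of fun j d => B.coeff i j d u).transpose * f *
    Matrix.of fun m e => B.coeff u m e n

/-- The coefficients of `f` after the last strand `x_q` has moved past it to become the first
strand `x_r`: the part in `V ⊗ V` of `(c ⊗ id)(id ⊗ c)(f ⊗ x_q)`. -/
def slideLeft (B : Braiding k ι) (q r : ι) (f : Matrix ι ι k) : Matrix ι ι k :=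
  ∑ s, (Matrix.of fun i d => B.coeff i s r d).transpose * f *
    Matrix.of fun j e => B.coeff j q s e

theorem slideRight_apply (i n d e : ι) :
    slideRight B i n f d e = ∑ j, ∑ m, f j m * ∑ u, B.coeff i j d u * B.coeff u m e n := by
  simp only [slideRight, Matrix.sum_apply, transpose_mul_mul_apply, Matrix.of_apply,
    Finset.mul_sum]
  rw [Finset.sum_comm]
  exact Finset.sum_congr rfl fun j _ => Finset.sum_comm

theorem slideLeft_apply (q r d e : ι) :
    slideLeft B q r f d e = ∑ i, ∑ j, f i j * ∑ s, B.coeff j q s e * B.coeff i s r d := by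
  simp only [slideLeft, Matrix.sum_apply, transpose_mul_mul_apply, Matrix.of_apply,
    Finset.mul_sum, mul_comm (B.coeff _ _ r d)]
  rw [Finset.sum_comm]
  exact Finset.sum_congr rfl fun j _ => Finset.sum_comm

theorem InKer.slideRight (hf : InKer B f) (i n : ι) : InKer B (slideRight B i n f) := by
  intro d e
  simp only [slideRight_apply, Finset.sum_mul, mul_assoc]
  rw [sum_sum_comm]
  refine (congrArg _ ?_).trans
    (hf.sum_smul_add fun j m => ∑ u, B.coeff i j d u * B.coeff u m e n)
  refine Finset.sum_congr rfl fun j _ => Finset.sum_congr rfl fun m _ => ?_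
  simp only [smul_eq_mul, ← Finset.mul_sum]
  rw [← B.braid]
  simp only [Finset.mul_sum]
  exact Finset.sum_congr rfl fun u _ => Finset.sum_comm

theorem InKer.slideLeft (hf : InKer B f) (q r : ι) : InKer B (slideLeft B q r f) := by
  intro d e
  simp only [slideLeft_apply, Finset.sum_mul, mul_assoc]
  rw [sum_sum_comm]
  refine (congrArg _ ?_).trans
    (hf.sum_smul_add fun i j => ∑ s, B.coeff j q s e * B.coeff i s r d)
  refine Finset.sum_congr rfl fun i _ => Finset.sum_congr rfl fun j _ => ?_
  simp only [smul_eq_mul, ← Finset.mul_sum]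
  rw [B.braid]
  simp only [Finset.mul_sum]
  rw [Finset.sum_comm]
  conv_rhs => rw [Finset.sum_comm]
  exact Finset.sum_congr rfl fun v _ => Finset.sum_comm

/-- Binomial formula: letters `L`, `R` with the commutation rule that `c` prescribes between
`x_i ⊗ 1` and `1 ⊗ x_i` have no cross terms in a quadratic element killed by `1 + c`. -/
theorem InKer.quad_add (hf : InKer B f) {A : Type*} [Semiring A] [Algebra k A] {L R : ι → A}
    (comm : ∀ i j, R i * L j = ∑ l, ∑ m, B.coeff i j l m • (L l * R m)) :
    quad (L + R) f = quad L f + quad R f := by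
  have cross : ∑ i, ∑ j, f i j • (L i * R j) + ∑ i, ∑ j, f i j • (R i * L j) = 0 := by
    simp only [comm]
    exact hf.sum_smul_add _
  have expand : quad (L + R) f = quad L f + quad R f +
      (∑ i, ∑ j, f i j • (L i * R j) + ∑ i, ∑ j, f i j • (R i * L j)) := by
    simp only [quad_apply, Pi.add_apply, add_mul, mul_add, smul_add, Finset.sum_add_distrib]
    abel
  rw [expand, cross, add_zero]

theorem quad_mul_of_comm {A : Type*} [Semiring A] [Algebra k A] {L R : ι → A}
    (comm : ∀ i j, R i * L j = ∑ l, ∑ m, B.coeff i j l m • (L l * R m)) (q : ι)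
    (f : Matrix ι ι k) :
    quad R f * L q = ∑ r, L r * quad R (slideLeft B q r f) := by
  have comm' (i j : ι) : R i * L j = ∑ l, L l * ∑ m, B.coeff i j l m • R m := by
    simp only [comm, Finset.mul_sum, mul_smul_comm]
  have key (i j : ι) : R i * R j * L q = ∑ r, ∑ s, L r *
      ((∑ d, B.coeff i s r d • R d) * ∑ e, B.coeff j q s e • R e) := by
    rw [mul_assoc, comm', Finset.mul_sum, Finset.sum_comm]
    refine Finset.sum_congr rfl fun s _ => ?_
    rw [← mul_assoc, comm', Finset.sum_mul]
    simp only [mul_assoc]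
  simp only [slideLeft, map_sum, quad_transpose_mul_mul, Matrix.of_apply]
  simp only [quad_apply, Finset.sum_mul, smul_mul_assoc, key, Finset.smul_sum, Finset.mul_sum,
    mul_smul_comm]
  exact sum_sum_comm _

end Quadratic

section HopfIdeal

variable {k ι : Type*} [Field k] [Fintype ι] [DecidableEq ι]

theorem extendEntry_one (B : Braiding k ι) (i j : ι) :
    extendEntry B i j 1 = if i = j then 1 else 0 := by
  simp only [extendEntry, LinearMap.comp_apply, AlgHom.toLinearMap_apply, map_one,
    Matrix.entryLinearMap_apply, Matrix.one_apply]

theorem extendEntry_mul (B : Braiding k ι) (i j : ι) (u v : T k ι) :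
    extendEntry B i j (u * v) = ∑ n, extendEntry B i n u * extendEntry B n j v := by
  simp only [extendEntry, LinearMap.comp_apply, AlgHom.toLinearMap_apply, map_mul,
    Matrix.entryLinearMap_apply, Matrix.mul_apply]

theorem extendEntry_ι (B : Braiding k ι) (i j m : ι) :
    extendEntry B i j (FreeAlgebra.ι k m) = ∑ l, B.coeff i m l j • FreeAlgebra.ι k l := by
  simp only [extendEntry, extend, LinearMap.comp_apply, AlgHom.toLinearMap_apply,
    FreeAlgebra.lift_ι_apply, Matrix.entryLinearMap_apply, Matrix.of_apply]

theorem extendEntry_ι_mul (B : Braiding k ι) (i j m : ι) (u : T k ι) :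
    extendEntry B i j (FreeAlgebra.ι k m * u) =
      ∑ l, ∑ n, B.coeff i m l n • (FreeAlgebra.ι k l * extendEntry B n j u) := by
  simp only [extendEntry_mul, extendEntry_ι, Finset.sum_mul, smul_mul_assoc]
  exact Finset.sum_comm

theorem extendEntry_quad (B : Braiding k ι) (i n : ι) (f : Matrix ι ι k) :
    extendEntry B i n (quad (FreeAlgebra.ι k) f) =
      quad (FreeAlgebra.ι k) (slideRight B i n f) := by
  simp only [slideRight, map_sum, quad_transpose_mul_mul, Matrix.of_apply, ← extendEntry_ι]
  simp only [quad_apply, map_sum, map_smul, extendEntry_mul, Finset.smul_sum]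
  exact (Finset.sum_congr rfl fun j _ => Finset.sum_comm).trans Finset.sum_comm

/-- The two-sided ideal generated by the kernel of `1 + c` on `V ⊗ V`. -/
def kerIdeal (B : Braiding k ι) : TwoSidedIdeal (T k ι) :=
  TwoSidedIdeal.span {r | ∃ f, InKer B f ∧ r = quad (FreeAlgebra.ι k) f}

variable {B : Braiding k ι} {f : Matrix ι ι k}

theorem quad_mem_kerIdeal (hf : InKer B f) : quad (FreeAlgebra.ι k) f ∈ kerIdeal B :=
  TwoSidedIdeal.subset_span ⟨f, hf, rfl⟩

theorem extendEntry_mem_kerIdeal (i j : ι) {u : T k ι} (hu : u ∈ kerIdeal B) :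
    extendEntry B i j u ∈ kerIdeal B := by
  have : toSub (kerIdeal B) ≤ ⨅ i, ⨅ j, (toSub (kerIdeal B)).comap (extendEntry B i j) := by
    refine toSub_span_le ?_ ?_ ?_
    · rintro _ ⟨f, hf, rfl⟩
      simp only [SetLike.mem_coe, Submodule.mem_iInf, Submodule.mem_comap, extendEntry_quad]
      exact fun i j => quad_mem_kerIdeal (hf.slideRight i j)
    all_goals
      intro m u hu
      simp only [Submodule.mem_iInf, Submodule.mem_comap, extendEntry_mul] at hu ⊢
    · exact fun i j => sum_mem fun n _ => (kerIdeal B).mul_mem_left _ _ (hu n j)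
    · exact fun i j => sum_mem fun n _ => (kerIdeal B).mul_mem_right _ _ (hu i n)
  simp only [SetLike.le_def, Submodule.mem_iInf] at this
  exact this hu i j

/-- Left multiplication by `1 ⊗ x_i` in the braided tensor product `T(V) ⊗ T(V)`. -/
noncomputable def mulSnd (B : Braiding k ι) (i : ι) : Module.End k (T k ι ⊗[k] T k ι) :=
  ∑ j, TensorProduct.map (extendEntry B i j) (LinearMap.mulLeft k (FreeAlgebra.ι k j))

theorem primitiveMul_eq (B : Braiding k ι) : primitiveMul B = mulFst k + mulSnd B := rfl

theorem mulSnd_tmul (i : ι) (u v : T k ι) :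
    mulSnd B i (u ⊗ₜ[k] v) = ∑ j, extendEntry B i j u ⊗ₜ (FreeAlgebra.ι k j * v) := by
  simp only [mulSnd, LinearMap.sum_apply, TensorProduct.map_tmul, LinearMap.mulLeft_apply]

theorem mulSnd_mul_mulFst (B : Braiding k ι) (i q : ι) :
    mulSnd B i * mulFst k q = ∑ r, ∑ n, B.coeff i q r n • (mulFst k r * mulSnd B n) := by
  refine TensorProduct.ext' fun u v => ?_
  simp only [Module.End.mul_apply, mulFst_tmul, mulSnd_tmul, extendEntry_ι_mul,
    LinearMap.sum_apply, LinearMap.smul_apply, map_sum, TensorProduct.sum_tmul,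
    Finset.smul_sum, ← TensorProduct.smul_tmul']
  exact Finset.sum_comm.trans <| Finset.sum_congr rfl fun l _ => Finset.sum_comm

theorem mulSnd_one_tmul (i : ι) (v : T k ι) :
    mulSnd B i (1 ⊗ₜ[k] v) = 1 ⊗ₜ (FreeAlgebra.ι k i * v) := by
  simp only [mulSnd_tmul, extendEntry_one, TensorProduct.ite_tmul, Finset.sum_ite_eq,
    Finset.mem_univ, if_true]

theorem quad_mulSnd_one_tmul (f : Matrix ι ι k) (v : T k ι) :
    quad (mulSnd B) f (1 ⊗ₜ[k] v) = 1 ⊗ₜ (quad (FreeAlgebra.ι k) f * v) := by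
  simp only [quad_apply, LinearMap.sum_apply, LinearMap.smul_apply, Module.End.mul_apply,
    mulSnd_one_tmul, Finset.sum_mul, smul_mul_assoc, mul_assoc, TensorProduct.tmul_sum,
    TensorProduct.tmul_smul]

theorem mulSnd_mem_coidealSub (i : ι) {z : T k ι ⊗[k] T k ι}
    (hz : z ∈ coidealSub (kerIdeal B)) : mulSnd B i z ∈ coidealSub (kerIdeal B) := by
  rw [mulSnd, LinearMap.sum_apply]
  exact sum_mem fun j _ => map_mem_coidealSub (fun u => extendEntry_mem_kerIdeal i j)
    (fun u => TwoSidedIdeal.mul_mem_left _ _ u) hz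

theorem quad_mulSnd_mem_coidealSub (hf : InKer B f) (z : T k ι ⊗[k] T k ι) :
    quad (mulSnd B) f z ∈ coidealSub (kerIdeal B) := by
  induction z using TensorProduct.induction_on with
  | zero =>
    rw [map_zero]
    exact zero_mem _
  | add x y hx hy =>
    rw [map_add]
    exact add_mem hx hy
  | tmul u v =>
    induction u using T_induction generalizing f with
    | one =>
      rw [quad_mulSnd_one_tmul]
      exact right_tmul_mem_coidealSub
        (TwoSidedIdeal.mul_mem_right _ _ _ (quad_mem_kerIdeal hf)) 1
    | mul q u hu =>
      rw [← mulFst_tmul, ← Module.End.mul_apply, quad_mul_of_comm (mulSnd_mul_mulFst B),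
        LinearMap.sum_apply]
      exact sum_mem fun r _ => mulFst_mem_coidealSub r (hu (hf.slideLeft q r))
    | add u₁ u₂ h₁ h₂ =>
      rw [TensorProduct.add_tmul, map_add]
      exact add_mem (h₁ hf) (h₂ hf)
    | smul r u hu =>
      rw [← TensorProduct.smul_tmul', map_smul]
      exact Submodule.smul_mem _ r (hu hf)

theorem quad_primitiveMul_mem_coidealSub (hf : InKer B f) (z : T k ι ⊗[k] T k ι) :
    quad (primitiveMul B) f z ∈ coidealSub (kerIdeal B) := by
  rw [primitiveMul_eq, hf.quad_add (mulSnd_mul_mulFst B), LinearMap.add_apply]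
  refine add_mem ?_ (quad_mulSnd_mem_coidealSub hf z)
  induction z using TensorProduct.induction_on with
  | zero =>
    rw [map_zero]
    exact zero_mem _
  | add x y hx hy =>
    rw [map_add]
    exact add_mem hx hy
  | tmul u v =>
    rw [quad_mulFst_tmul]
    exact left_tmul_mem_coidealSub (TwoSidedIdeal.mul_mem_right _ _ _ (quad_mem_kerIdeal hf)) v

/-- The action of `T(V)` on `T(V) ⊗ T(V)` by left multiplication through the comultiplication. -/
noncomputable def coact (B : Braiding k ι) : T k ι →ₐ[k] Module.End k (T k ι ⊗[k] T k ι) :=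
  FreeAlgebra.lift k (primitiveMul B)

theorem coact_ι_mul_apply (B : Braiding k ι) (i : ι) (u : T k ι) (z : T k ι ⊗[k] T k ι) :
    coact B (FreeAlgebra.ι k i * u) z = primitiveMul B i (coact B u z) := by
  rw [map_mul, Module.End.mul_apply, coact, FreeAlgebra.lift_ι_apply]

theorem coact_quad (B : Braiding k ι) (f : Matrix ι ι k) :
    coact B (quad (FreeAlgebra.ι k) f) = quad (primitiveMul B) f := by
  rw [map_quad, coact, FreeAlgebra.ι_comp_lift]

theorem coact_mem_coidealSub {u : T k ι} (hu : u ∈ kerIdeal B) (z : T k ι ⊗[k] T k ι) :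
    coact B u z ∈ coidealSub (kerIdeal B) := by
  have : toSub (kerIdeal B) ≤ ⨅ z, (coidealSub (kerIdeal B)).comap
      ((coact B).toLinearMap.flip z) := by
    refine toSub_span_le ?_ ?_ ?_
    · rintro _ ⟨f, hf, rfl⟩
      simp only [SetLike.mem_coe, Submodule.mem_iInf, Submodule.mem_comap, LinearMap.flip_apply,
        AlgHom.toLinearMap_apply, coact_quad]
      exact quad_primitiveMul_mem_coidealSub hf
    all_goals
      intro i u hu
      simp only [Submodule.mem_iInf, Submodule.mem_comap, LinearMap.flip_apply,
        AlgHom.toLinearMap_apply, map_mul, Module.End.mul_apply] at hu ⊢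
    · intro z
      rw [coact, FreeAlgebra.lift_ι_apply, primitiveMul_eq]
      exact add_mem (mulFst_mem_coidealSub i (hu z)) (mulSnd_mem_coidealSub i (hu z))
    · exact fun z => hu _
  simp only [SetLike.le_def, Submodule.mem_iInf] at this
  exact this hu z

theorem kerIdeal_isHopfIdeal (B : Braiding k ι) : IsHopfIdeal B (kerIdeal B) where
  homogeneous := span_homogeneous (by
    rintro _ ⟨f, -, rfl⟩
    exact quad_mem_deg f)
  coideal u hu := coact_mem_coidealSub hu (1 ⊗ₜ 1)

theorem quad_mem_nicholsIdeal (hf : InKer B f) : quad (FreeAlgebra.ι k) f ∈ nicholsIdeal B :=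
  (nicholsIdeal_isGreatest B).2 (kerIdeal_isHopfIdeal B) (quad_mem_kerIdeal hf)

end HopfIdeal

section SkewDerivations

variable {k ι : Type*} [Field k]

/-- The counit of the tensor algebra. -/
noncomputable def counit (k ι : Type*) [Field k] : T k ι →ₐ[k] k := FreeAlgebra.lift k fun _ => 0

@[simp] theorem counit_ι_mul (i : ι) (u : T k ι) : counit k ι (FreeAlgebra.ι k i * u) = 0 := by
  simp [counit]

/-- Contraction of the first tensor factor with a linear functional. -/
noncomputable def contract (φ : T k ι →ₗ[k] k) : T k ι ⊗[k] T k ι →ₗ[k] T k ι :=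
  (TensorProduct.lid k (T k ι)).toLinearMap ∘ₗ TensorProduct.map φ LinearMap.id

@[simp] theorem contract_tmul (φ : T k ι →ₗ[k] k) (u v : T k ι) :
    contract φ (u ⊗ₜ[k] v) = φ u • v := by
  simp [contract]

variable [DecidableEq ι]

/-- The coefficient of the generator `x_l`. It is read off in the dual numbers `k[ε]`, after
`x_l ↦ ε` and `x_i ↦ 0` for `i ≠ l`. -/
noncomputable def linCoeff (k : Type*) [Field k] (l : ι) : T k ι →ₗ[k] k :=
  (TrivSqZeroExt.sndHom k k).restrictScalars k ∘ₗ
    (FreeAlgebra.lift k (A := TrivSqZeroExt k k)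
      fun i => TrivSqZeroExt.inr (if i = l then 1 else 0)).toLinearMap

@[simp] theorem linCoeff_one (l : ι) : linCoeff k l 1 = 0 := by
  simp [linCoeff]

@[simp] theorem linCoeff_ι_mul (l i : ι) (u : T k ι) :
    linCoeff k l (FreeAlgebra.ι k i * u) = if i = l then counit k ι u else 0 := by
  have fst_lift : (TrivSqZeroExt.fstHom k k k).comp (FreeAlgebra.lift k
      fun i => TrivSqZeroExt.inr (if i = l then 1 else 0)) = counit k ι :=
    FreeAlgebra.hom_ext <| funext fun i => by
      simp only [counit, Function.comp_apply, AlgHom.comp_apply, FreeAlgebra.lift_ι_apply,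
        TrivSqZeroExt.fstHom_apply, TrivSqZeroExt.fst_inr]
  simp only [linCoeff, LinearMap.comp_apply, AlgHom.toLinearMap_apply, map_mul,
    FreeAlgebra.lift_ι_apply, LinearMap.coe_restrictScalars, TrivSqZeroExt.sndHom_apply,
    TrivSqZeroExt.snd_mul, TrivSqZeroExt.fst_inr, TrivSqZeroExt.snd_inr, ← fst_lift,
    AlgHom.comp_apply, TrivSqZeroExt.fstHom_apply]
  simp

variable [Fintype ι] {B : Braiding k ι}

theorem eq_zero_of_mem_nicholsIdeal {M : Type*} [AddCommGroup M] [Module k M] {φ : T k ι →ₗ[k] M}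
    (hφ : ∀ i j u, φ (FreeAlgebra.ι k i * (FreeAlgebra.ι k j * u)) = 0) {u : T k ι}
    (hu : u ∈ nicholsIdeal B) : φ u = 0 := by
  have deg_le : ∀ n ≥ 2, deg k ι n ≤ LinearMap.ker φ := fun n hn => Submodule.span_le.2 <| by
    rintro _ ⟨w, rfl, rfl⟩
    match w, hn with
    | i :: j :: w, _ => exact hφ i j _
  have h := (nicholsIdeal_isGreatest B).1.homogeneous hu
  exact iSup₂_le (a := LinearMap.ker φ) (fun n hn => inf_le_right.trans (deg_le n hn)) h

theorem linCoeff_eq_zero (l : ι) {u : T k ι} (hu : u ∈ nicholsIdeal B) : linCoeff k l u = 0 :=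
  eq_zero_of_mem_nicholsIdeal (fun i j u => by simp) hu

theorem counit_eq_zero {u : T k ι} (hu : u ∈ nicholsIdeal B) : counit k ι u = 0 :=
  eq_zero_of_mem_nicholsIdeal (φ := (counit k ι).toLinearMap) (fun i j u => by simp) hu

theorem counit_extendEntry (B : Braiding k ι) (i j : ι) (u : T k ι) :
    counit k ι (extendEntry B i j u) = if i = j then counit k ι u else 0 := by
  induction u using T_induction generalizing i j with
  | one => simp [extendEntry_one, apply_ite (counit k ι)]
  | mul q u _ => simp [extendEntry_ι_mul]
  | add u v hu hv => simp [hu, hv, ← ite_add_zero]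
  | smul r u hu => simp [hu]

theorem linCoeff_extendEntry (B : Braiding k ι) (i j l : ι) (u : T k ι) :
    linCoeff k l (extendEntry B i j u) = ∑ m, B.coeff i m l j * linCoeff k m u := by
  induction u using T_induction generalizing i j with
  | one => simp [extendEntry_one, apply_ite (linCoeff k l)]
  | mul q u _ => simp [extendEntry_ι_mul, counit_extendEntry]
  | add u v hu hv => simp [hu, hv, mul_add, Finset.sum_add_distrib]
  | smul r u hu => simp [hu, Finset.mul_sum, mul_left_comm]

theorem comul_one (B : Braiding k ι) : comul B 1 = 1 ⊗ₜ[k] 1 := by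
  simp [comul]

theorem comul_ι_mul (B : Braiding k ι) (i : ι) (u : T k ι) :
    comul B (FreeAlgebra.ι k i * u) = primitiveMul B i (comul B u) :=
  coact_ι_mul_apply B i u _

theorem contract_counit_primitiveMul (B : Braiding k ι) (i : ι) (z : T k ι ⊗[k] T k ι) :
    contract (counit k ι).toLinearMap (primitiveMul B i z) =
      FreeAlgebra.ι k i * contract (counit k ι).toLinearMap z := by
  induction z using TensorProduct.induction_on with
  | zero => simp
  | add x y hx hy => rw [map_add, map_add, map_add, hx, hy, mul_add]
  | tmul u v => simp [primitiveMul_eq, mulFst_tmul, mulSnd_tmul, counit_extendEntry]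

theorem contract_counit_comul (B : Braiding k ι) (u : T k ι) :
    contract (counit k ι).toLinearMap (comul B u) = u := by
  induction u using T_induction with
  | one => simp [comul_one]
  | mul i u hu => rw [comul_ι_mul, contract_counit_primitiveMul, hu]
  | add u v hu hv => rw [map_add, map_add, hu, hv]
  | smul r u hu => rw [map_smul, map_smul, hu]

/-- The skew derivation `∂_l` of the tensor algebra: `Δ u` is `∑ l, x_l ⊗ ∂_l u` up to terms whose
first tensor factor is not of degree one. -/
noncomputable def der (B : Braiding k ι) (l : ι) : T k ι →ₗ[k] T k ι :=
  contract (linCoeff k l) ∘ₗ comul B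

@[simp] theorem der_one (B : Braiding k ι) (l : ι) : der B l 1 = 0 := by
  simp [der, comul_one]

theorem contract_linCoeff_primitiveMul (B : Braiding k ι) (l i : ι) (z : T k ι ⊗[k] T k ι) :
    contract (linCoeff k l) (primitiveMul B i z) =
      (if i = l then (1 : k) else 0) • contract (counit k ι).toLinearMap z +
      ∑ j, ∑ m, B.coeff i m l j • (FreeAlgebra.ι k j * contract (linCoeff k m) z) := by
  induction z using TensorProduct.induction_on with
  | zero => simp
  | add x y hx hy =>
    simp only [map_add, hx, hy, mul_add, smul_add, Finset.sum_add_distrib]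
    abel
  | tmul u v =>
    simp [primitiveMul_eq, mulFst_tmul, mulSnd_tmul, linCoeff_extendEntry, Finset.sum_smul,
      mul_smul, ite_smul]

theorem der_ι_mul (B : Braiding k ι) (l i : ι) (u : T k ι) :
    der B l (FreeAlgebra.ι k i * u) = (if i = l then (1 : k) else 0) • u +
      ∑ j, ∑ m, B.coeff i m l j • (FreeAlgebra.ι k j * der B m u) := by
  simp only [der, LinearMap.comp_apply, comul_ι_mul, contract_linCoeff_primitiveMul,
    contract_counit_comul]

theorem der_mem_nicholsIdeal (l : ι) {u : T k ι} (hu : u ∈ nicholsIdeal B) :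
    der B l u ∈ nicholsIdeal B := by
  have : coidealSub (nicholsIdeal B) ≤
      (toSub (nicholsIdeal B)).comap (contract (linCoeff k l)) := Submodule.span_le.2 <| by
    rintro _ ⟨u, v, hu | hv, rfl⟩
    · simp [linCoeff_eq_zero l hu]
    · simpa using Submodule.smul_mem _ _ (mem_toSub.2 hv)
  exact this ((nicholsIdeal_isGreatest B).1.coideal u hu)

theorem linCoeff_der_quad (f : Matrix ι ι k) (l m : ι) :
    linCoeff k m (der B l (quad (FreeAlgebra.ι k) f)) =
      f l m + ∑ i, ∑ j, f i j * B.coeff i j l m := by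
  have der_ι (i j : ι) : der B i (FreeAlgebra.ι k j) = (if j = i then (1 : k) else 0) • 1 := by
    simpa using der_ι_mul B i j 1
  have linCoeff_ι (i j : ι) : linCoeff k i (FreeAlgebra.ι k j) = if j = i then 1 else 0 := by
    simpa using linCoeff_ι_mul (k := k) i j 1
  simp only [quad_apply, map_sum, map_smul, der_ι_mul, der_ι, map_add, linCoeff_ι_mul,
    linCoeff_ι, smul_eq_mul, mul_add, Finset.sum_add_distrib]
  simp

theorem quad_mem_nicholsIdeal_iff {f : Matrix ι ι k} :
    quad (FreeAlgebra.ι k) f ∈ nicholsIdeal B ↔ InKer B f :=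
  ⟨fun hf l m => linCoeff_der_quad f l m ▸ linCoeff_eq_zero m (der_mem_nicholsIdeal l hf),
    quad_mem_nicholsIdeal⟩

theorem quadraticRelations_eq_bot (h : ∀ f, InKer B f → f = 0) : quadraticRelations B = ⊥ := by
  rw [eq_bot_iff]
  rintro u ⟨hu, hdeg⟩
  obtain ⟨f, rfl⟩ := deg_two_le_range_quad hdeg
  rw [h f (quad_mem_nicholsIdeal_iff.1 hu), map_zero]
  exact zero_mem _

end SkewDerivations

section Relations

variable {k : Type*} [Field k]

/-- The generators of the tensor algebra in rank three. -/
noncomputable abbrev gen (k : Type*) [Field k] (i : Fin 3) : T k (Fin 3) := FreeAlgebra.ι k i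

variable {t a b p : k} {ht : t ≠ 0}

theorem inKer_braiding14_iff (f : Matrix (Fin 3) (Fin 3) k) :
    InKer (braiding14 t a b p ht) f ↔
      f + t • !![f 0 0 + a * f 2 0 - a * f 0 2 - a * b * f 2 2,
          f 1 0 + (a - 2 * b) * f 1 2 + p * f 2 2, f 2 0 - b * f 2 2;
        f 0 1 + (2 * b - a) * f 2 1, f 1 1, f 2 1;
        f 0 2 + b * f 2 2, f 1 2, f 2 2] = 0 := by
  rw [← Matrix.ext_iff]
  refine forall₂_congr fun l m => Eq.congr_left ?_
  fin_cases l <;> fin_cases m <;>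
    simp [braiding14, r14, R14, Fin.sum_univ_three, finProdFinEquiv] <;> ring

theorem eq_zero_of_inKer_braiding14 (ht2 : t ^ 2 ≠ 1) {f : Matrix (Fin 3) (Fin 3) k}
    (hf : InKer (braiding14 t a b p ht) f) : f = 0 := by
  have entry (l m : Fin 3) := congr_fun₂ ((inKer_braiding14_iff f).1 hf) l m
  have vanish {x y : k} (hxy : x + t * y = 0) (hyx : y + t * x = 0) : x = 0 :=
    (mul_eq_zero.1 (by linear_combination hxy - t * hyx : (1 - t ^ 2) * x = 0)).resolve_left
      (sub_ne_zero.2 ht2.symm)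
  have h22 : f 2 2 = 0 := vanish (entry 2 2) (entry 2 2)
  have h11 : f 1 1 = 0 := vanish (entry 1 1) (entry 1 1)
  have h12 : f 1 2 = 0 := vanish (entry 1 2) (entry 2 1)
  have h21 : f 2 1 = 0 := vanish (entry 2 1) (entry 1 2)
  have e02 : f 0 2 + t * f 2 0 = 0 := by simpa [h22] using entry 0 2
  have e20 : f 2 0 + t * f 0 2 = 0 := by simpa [h22] using entry 2 0
  have e01 : f 0 1 + t * f 1 0 = 0 := by simpa [h22, h12] using entry 0 1
  have e10 : f 1 0 + t * f 0 1 = 0 := by simpa [h21] using entry 1 0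
  have h02 : f 0 2 = 0 := vanish e02 e20
  have h20 : f 2 0 = 0 := vanish e20 e02
  have e00 : f 0 0 + t * f 0 0 = 0 := by simpa [h22, h02, h20] using entry 0 0
  ext i j
  fin_cases i <;> fin_cases j
  exacts [vanish e00 e00, vanish e01 e10, h02, vanish e10 e01, h11, h12, h20, h21, h22]

/-- The relations of the Nichols algebra for `t = 1`. -/
def relSym (a b : k) : Set (T k (Fin 3)) :=
  {gen k 1 * gen k 0 - gen k 0 * gen k 1,
    gen k 2 * gen k 0 - gen k 0 * gen k 2 - a • gen k 0 ^ 2,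
    gen k 2 * gen k 1 - gen k 1 * gen k 2 + (a - 2 * b) • (gen k 0 * gen k 1)}

/-- The relations of the Nichols algebra for `t = -1` and `p ≠ 0`. -/
def relExt (a b : k) : Set (T k (Fin 3)) :=
  {gen k 1 * gen k 0 + gen k 0 * gen k 1,
    gen k 2 * gen k 0 + gen k 0 * gen k 2,
    gen k 2 * gen k 1 + gen k 1 * gen k 2 + (a - 2 * b) • (gen k 0 * gen k 1),
    gen k 0 ^ 2, gen k 1 ^ 2}

/-- The relations of the Nichols algebra for `t = -1` and `p = 0`. -/
def relFin (a b : k) : Set (T k (Fin 3)) :=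
  {gen k 1 * gen k 0 + gen k 0 * gen k 1,
    gen k 2 * gen k 0 + gen k 0 * gen k 2,
    gen k 2 * gen k 1 + gen k 1 * gen k 2 + (a - 2 * b) • (gen k 0 * gen k 1),
    gen k 0 ^ 2, gen k 1 ^ 2, gen k 2 ^ 2 - b • (gen k 0 * gen k 2)}

theorem relExt_subset_relFin (a b : k) : relExt a b ⊆ relFin a b := by
  rintro u (rfl | rfl | rfl | rfl | rfl) <;> simp [relFin]

theorem mem_nicholsIdeal_of_inKer {B : Braiding k (Fin 3)} {f : Matrix (Fin 3) (Fin 3) k}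
    (hf : InKer B f) {u : T k (Fin 3)} (hu : ∑ i, ∑ j, f i j • (gen k i * gen k j) = u) :
    u ∈ nicholsIdeal B := by
  rw [← hu, ← quad_apply]
  exact quad_mem_nicholsIdeal hf

theorem relSym_subset_nicholsIdeal {ht : (1 : k) ≠ 0} :
    relSym a b ⊆ nicholsIdeal (braiding14 1 a b p ht) := by
  have inKer (f) := (inKer_braiding14_iff (t := 1) (a := a) (b := b) (p := p) (ht := ht) f).2
  rintro u (rfl | rfl | rfl)
  on_goal 1 => refine mem_nicholsIdeal_of_inKer (inKer !![0, -1, 0; 1, 0, 0; 0, 0, 0] ?_) ?_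
  on_goal 3 => refine mem_nicholsIdeal_of_inKer (inKer !![-a, 0, -1; 0, 0, 0; 1, 0, 0] ?_) ?_
  on_goal 5 =>
    refine mem_nicholsIdeal_of_inKer (inKer !![0, a - 2 * b, 0; 0, 0, -1; 0, 1, 0] ?_) ?_
  all_goals simp [Fin.sum_univ_three, pow_two, ← Matrix.ext_iff, Fin.forall_fin_succ] <;> abel

theorem relExt_subset_nicholsIdeal {ht : (-1 : k) ≠ 0} :
    relExt a b ⊆ nicholsIdeal (braiding14 (-1) a b p ht) := by
  have inKer (f) := (inKer_braiding14_iff (t := -1) (a := a) (b := b) (p := p) (ht := ht) f).2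
  rintro u (rfl | rfl | rfl | rfl | rfl)
  on_goal 1 => refine mem_nicholsIdeal_of_inKer (inKer !![0, 1, 0; 1, 0, 0; 0, 0, 0] ?_) ?_
  on_goal 3 => refine mem_nicholsIdeal_of_inKer (inKer !![0, 0, 1; 0, 0, 0; 1, 0, 0] ?_) ?_
  on_goal 5 =>
    refine mem_nicholsIdeal_of_inKer (inKer !![0, a - 2 * b, 0; 0, 0, 1; 0, 1, 0] ?_) ?_
  on_goal 7 => refine mem_nicholsIdeal_of_inKer (inKer !![1, 0, 0; 0, 0, 0; 0, 0, 0] ?_) ?_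
  on_goal 9 => refine mem_nicholsIdeal_of_inKer (inKer !![0, 0, 0; 0, 1, 0; 0, 0, 0] ?_) ?_
  all_goals simp [Fin.sum_univ_three, pow_two, ← Matrix.ext_iff, Fin.forall_fin_succ] <;> abel

theorem relFin_subset_nicholsIdeal {ht : (-1 : k) ≠ 0} :
    relFin a b ⊆ nicholsIdeal (braiding14 (-1) a b 0 ht) := by
  have hExt := relExt_subset_nicholsIdeal (a := a) (b := b) (p := 0) (ht := ht)
  have hSq : InKer (braiding14 (-1) a b 0 ht) !![0, 0, -b; 0, 0, 0; 0, 0, 1] :=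
    (inKer_braiding14_iff _).2 (by simp [← Matrix.ext_iff, Fin.forall_fin_succ])
  rintro u (rfl | rfl | rfl | rfl | rfl | rfl)
  iterate 5 exact hExt (by simp [relExt])
  exact mem_nicholsIdeal_of_inKer hSq (by simp [Fin.sum_univ_three, pow_two]; abel)

end Relations

section SkewPowers

variable {k A : Type*} [CommRing k] [Ring A] [Algebra k A]

/-- The `c`-analogue `1 + c + ⋯ + c ^ (n - 1)` of the number `n`. -/
def qNat (c : k) (n : ℕ) : k := ∑ i ∈ Finset.range n, c ^ i

theorem qNat_zero (c : k) : qNat c 0 = 0 := Finset.sum_range_zero _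

theorem qNat_one (c : k) : qNat c 1 = 1 := by simp [qNat]

theorem qNat_succ (c : k) (n : ℕ) : qNat c (n + 1) = 1 + c * qNat c n := by
  simp [qNat, Finset.sum_range_succ', Finset.mul_sum, pow_succ', add_comm]

theorem qNat_succ_right (c : k) (n : ℕ) : qNat c (n + 1) = qNat c n + c ^ n :=
  Finset.sum_range_succ _ _

theorem qNat_neg_one (n : ℕ) : qNat (-1 : k) n = (n % 2 : ℕ) := by
  induction n with
  | zero => simp [qNat_zero]
  | succ n ih =>
    rw [qNat_succ, ih]
    rcases Nat.mod_two_eq_zero_or_one n with h | h <;> simp [h, Nat.add_mod]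

/-- The `c`-analogue of the falling factorial `m (m - 1) ⋯ (m - N + 1)`. The subtraction is
truncated, so the product vanishes for `m < N`. -/
def qDescFactorial (c : k) (m N : ℕ) : k := ∏ i ∈ Finset.range N, qNat c (m - i)

theorem qDescFactorial_of_lt (c : k) {m N : ℕ} (h : m < N) : qDescFactorial c m N = 0 :=
  Finset.prod_eq_zero (Finset.mem_range.2 h) (by rw [Nat.sub_self, qNat_zero])

theorem qDescFactorial_succ (c : k) (m N : ℕ) :
    qDescFactorial c m (N + 1) = qDescFactorial c m N * qNat c (m - N) :=
  Finset.prod_range_succ _ _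

theorem qDescFactorial_one_self_ne_zero [IsDomain k] [CharZero k] (N : ℕ) :
    qDescFactorial (1 : k) N N ≠ 0 := by
  refine Finset.prod_ne_zero_iff.2 fun i hi => ?_
  have : N - i ≠ 0 := Nat.sub_ne_zero_of_lt (Finset.mem_range.1 hi)
  simpa [qNat]

theorem qDescFactorial_self_ne_zero_of_lt_two [Nontrivial k] (c : k) {N : ℕ} (hN : N < 2) :
    qDescFactorial c N N ≠ 0 := by
  interval_cases N <;> simp [qDescFactorial, qNat_one]

theorem pow_apply_pow_mul_of_commute {D : Module.End k A} {x : A} {c : k}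
    (hD : ∀ u, D (x * u) = c • (x * D u)) (N n : ℕ) (u : A) :
    (D ^ N) (x ^ n * u) = c ^ (n * N) • (x ^ n * (D ^ N) u) := by
  have apply_pow_mul (u : A) : D (x ^ n * u) = c ^ n • (x ^ n * D u) := by
    induction n with
    | zero => simp
    | succ n ih =>
      rw [pow_succ', mul_assoc, hD, ih, mul_smul_comm, smul_smul, mul_assoc, pow_succ']
  induction N with
  | zero => simp
  | succ N ih =>
    rw [pow_succ', Module.End.mul_apply, ih, map_smul, apply_pow_mul, smul_smul, ← pow_add,
      Module.End.mul_apply, mul_add_one]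

variable {D : Module.End k A} {x w : A} {c : k}

theorem skew_apply_pow_mul (hD : ∀ n, D (x * (x ^ n * w)) = x ^ n * w + c • (x * D (x ^ n * w)))
    (hw : D w = 0) (n : ℕ) : D (x ^ n * w) = qNat c n • (x ^ (n - 1) * w) := by
  have apply_pow_succ (n : ℕ) : D (x ^ (n + 1) * w) = qNat c (n + 1) • (x ^ n * w) := by
    induction n with
    | zero => simpa [hw, qNat_one] using hD 0
    | succ n ih =>
      rw [pow_succ', mul_assoc, hD, ih, qNat_succ c (n + 1), mul_smul_comm, add_smul, one_smul,
        mul_smul, ← mul_assoc x, ← pow_succ']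
  cases n with
  | zero => simp [hw, qNat_zero]
  | succ n => exact apply_pow_succ n

theorem skew_pow_apply_pow_mul
    (hD : ∀ n, D (x * (x ^ n * w)) = x ^ n * w + c • (x * D (x ^ n * w)))
    (hw : D w = 0) (N m : ℕ) :
    (D ^ N) (x ^ m * w) = qDescFactorial c m N • (x ^ (m - N) * w) := by
  induction N with
  | zero => simp [qDescFactorial]
  | succ N ih =>
    rw [pow_succ', Module.End.mul_apply, ih, map_smul, skew_apply_pow_mul hD hw, smul_smul,
      qDescFactorial_succ, Nat.sub_sub]

end SkewPowers

section Degree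

variable {k ι : Type*} [Field k]

/-- The span of the words of length less than `n`. -/
def degLT (k ι : Type*) [Field k] (n : ℕ) : Submodule k (T k ι) :=
  Submodule.span k {w | ∃ l : List ι, l.length < n ∧ w = (l.map (FreeAlgebra.ι k)).prod}

theorem degLT_zero : degLT k ι 0 = ⊥ := by simp [degLT]

theorem degLT_one : degLT k ι 1 = Submodule.span k {1} := by
  simp [degLT]

theorem ι_mul_mem_degLT (i : ι) {n : ℕ} {u : T k ι} (hu : u ∈ degLT k ι n) :
    FreeAlgebra.ι k i * u ∈ degLT k ι (n + 1) := by
  have : degLT k ι n ≤ (degLT k ι (n + 1)).comap (LinearMap.mulLeft k (FreeAlgebra.ι k i)) := by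
    refine Submodule.span_le.2 ?_
    rintro _ ⟨l, hl, rfl⟩
    exact Submodule.subset_span ⟨i :: l, Nat.succ_lt_succ hl, by simp⟩
  exact this hu

theorem ι_pow_mem_degLT (i : ι) (n : ℕ) : FreeAlgebra.ι k i ^ n ∈ degLT k ι (n + 1) :=
  Submodule.subset_span ⟨List.replicate n i, by simp, by simp⟩

/-- The operator `D` lowers the degree of noncommutative polynomials by at least `d`; in
particular it kills those of degree less than `d`. -/
def LowersDegree (d : ℕ) (D : Module.End k (T k ι)) : Prop :=
  ∀ n, degLT k ι n ≤ (degLT k ι (n - d)).comap D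

namespace LowersDegree

theorem mul {d d' : ℕ} {D D' : Module.End k (T k ι)} (hD : LowersDegree d D)
    (hD' : LowersDegree d' D') : LowersDegree (d + d') (D * D') := fun n u hu => by
  simpa [Nat.sub_sub, add_comm] using hD _ (hD' n hu)

theorem pow {d : ℕ} {D : Module.End k (T k ι)} (hD : LowersDegree d D) (N : ℕ) :
    LowersDegree (d * N) (D ^ N) := by
  induction N with
  | zero => exact fun n u hu => by simpa
  | succ N ih => exact pow_succ D N ▸ ih.mul hD

theorem apply_ι_pow_of_lt {d : ℕ} {D : Module.End k (T k ι)} (hD : LowersDegree d D) (i : ι)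
    {n : ℕ} (h : n < d) : D (FreeAlgebra.ι k i ^ n) = 0 := by
  have := hD _ (ι_pow_mem_degLT i n)
  rwa [Nat.sub_eq_zero_of_le h, degLT_zero] at this

theorem exists_apply_ι_pow_self {n : ℕ} {D : Module.End k (T k ι)} (hD : LowersDegree n D) (i : ι) :
    ∃ r : k, D (FreeAlgebra.ι k i ^ n) = r • 1 := by
  have := hD _ (ι_pow_mem_degLT i n)
  rw [Nat.add_sub_cancel_left, degLT_one] at this
  exact (Submodule.mem_span_singleton.1 this).imp fun _ => Eq.symm

end LowersDegree

theorem lowersDegree_der [Fintype ι] [DecidableEq ι] (B : Braiding k ι) (l : ι) :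
    LowersDegree 1 (der B l) := fun n => Submodule.span_le.2 <| by
  rintro _ ⟨w, hw, rfl⟩
  induction w generalizing l n with
  | nil => simp
  | cons i w ih =>
    obtain ⟨n, rfl⟩ : ∃ m, n = m + 2 :=
      Nat.exists_eq_add_of_le' (by rw [List.length_cons] at hw; omega)
    have hw : w.length < n + 1 := Nat.lt_of_succ_lt_succ hw
    rw [List.map_cons, List.prod_cons, SetLike.mem_coe, Submodule.mem_comap, der_ι_mul]
    refine add_mem (Submodule.smul_mem _ _ (Submodule.subset_span ⟨w, hw, rfl⟩))
      (sum_mem fun j _ => sum_mem fun m _ => Submodule.smul_mem _ _ ?_)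
    exact ι_mul_mem_degLT j (ih m (n + 1) hw)

end Degree

section Triangular

theorem linearIndependent_of_triangular {k M N I R : Type*} [Ring k] [NoZeroDivisors k]
    [AddCommGroup M] [Module k M] [AddCommGroup N] [Module k N] [LinearOrder R] (f : M →ₗ[k] N)
    (v : I → M) (φ : I → M →ₗ[k] k) (r : I → R)
    (hker : ∀ i, LinearMap.ker f ≤ LinearMap.ker (φ i))
    (hdiag : ∀ i, φ i (v i) ≠ 0) (htri : ∀ i j, j ≠ i → r j ≤ r i → φ i (v j) = 0) :
    LinearIndependent k (f ∘ v) := by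
  rw [linearIndependent_iff']
  intro s g hg
  by_contra! hne
  classical
  obtain ⟨i, hi, hmax⟩ := (s.filter fun i => g i ≠ 0).exists_max_image r
    (by simpa [Finset.filter_nonempty_iff] using hne)
  obtain ⟨his, hgi⟩ := Finset.mem_filter.1 hi
  have hφ : φ i (∑ j ∈ s, g j • v j) = 0 := hker i (by simpa using hg)
  refine mul_ne_zero hgi (hdiag i) ?_
  rw [map_sum, Finset.sum_eq_single i] at hφ
  · simpa using hφ
  · intro j hj hji
    by_cases hgj : g j = 0
    · simp [hgj]
    · rw [map_smul, htri i j hji (hmax j (Finset.mem_filter.2 ⟨hj, hgj⟩)), smul_zero]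
  · exact fun h => absurd his h

end Triangular

section Lower

open Polynomial

variable {k : Type*} [CommRing k]

/-- The operator `X ^ n ↦ c n • X ^ (n - d)` on polynomials. The subtraction is truncated, which
is harmless for coefficients with `c n = 0` whenever `n < d`. -/
noncomputable def lower (d : ℕ) (c : ℕ → k) : Module.End k k[X] :=
  (basisMonomials k).constr k fun n => c n • X ^ (n - d)

theorem lower_X_pow (d : ℕ) (c : ℕ → k) (n : ℕ) : lower d c (X ^ n) = c n • X ^ (n - d) := by
  simpa [lower, ← X_pow_eq_monomial] using
    (basisMonomials k).constr_basis k (fun n => c n • (X : k[X]) ^ (n - d)) n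

theorem lower_one (d : ℕ) {c : ℕ → k} (hc : c 0 = 0) : lower d c 1 = 0 := by
  simpa [hc] using lower_X_pow d c 0

theorem lower_pow_X_pow (d : ℕ) (c : ℕ → k) (N m : ℕ) :
    (lower d c ^ N) (X ^ m) = (∏ i ∈ Finset.range N, c (m - d * i)) • X ^ (m - d * N) := by
  induction N with
  | zero => simp
  | succ N ih =>
    rw [pow_succ', Module.End.mul_apply, ih, map_smul, lower_X_pow, smul_smul,
      Finset.prod_range_succ, Nat.sub_sub, mul_add_one]

theorem hom_ext_X_pow {M : Type*} [AddCommGroup M] [Module k M] {f g : k[X] →ₗ[k] M}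
    (h : ∀ n, f (X ^ n) = g (X ^ n)) : f = g :=
  (basisMonomials k).ext fun n => by simpa [X_pow_eq_monomial] using h n

theorem lower_qNat_X_mul (t : k) (f : k[X]) :
    lower 1 (qNat t) (X * f) = f + t • (X * lower 1 (qNat t) f) := by
  have : lower 1 (qNat t) ∘ₗ LinearMap.mulLeft k X =
      LinearMap.id + t • (LinearMap.mulLeft k X ∘ₗ lower 1 (qNat t)) := hom_ext_X_pow fun n => by
    cases n with
    | zero => simpa [lower_one, qNat_zero, qNat_one] using lower_X_pow 1 (qNat t) 1
    | succ n =>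
      simp [← pow_succ', lower_X_pow, qNat_succ t (n + 1), add_smul, mul_smul]
  exact LinearMap.congr_fun this f

theorem lower_half_X_mul (p : k) (f : k[X]) :
    lower 2 (fun n => -p * (n / 2 : ℕ)) (X * f) =
      X * lower 2 (fun n => -p * (n / 2 : ℕ)) f - p • lower 1 (qNat (-1)) f := by
  set c : ℕ → k := fun n => -p * (n / 2 : ℕ) with hc
  have : lower 2 c ∘ₗ LinearMap.mulLeft k X =
      LinearMap.mulLeft k X ∘ₗ lower 2 c - p • lower 1 (qNat (-1)) := hom_ext_X_pow fun n => by
    suffices c (n + 1) • (X : k[X]) ^ (n - 1) =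
        c n • (X * X ^ (n - 2)) - (p * (n % 2 : ℕ)) • X ^ (n - 1) by
      simpa [← pow_succ', lower_X_pow, qNat_neg_one, mul_smul] using this
    match n with
    | 0 => simp [hc]
    | 1 => simp [hc]
    | n + 2 =>
      have half_succ : (n + 2 + 1) / 2 = (n + 2) / 2 + (n + 2) % 2 := by omega
      simp only [hc, half_succ, Nat.add_sub_cancel, Nat.add_succ_sub_one, ← pow_succ', ← sub_smul]
      push_cast
      ring_nf
  exact LinearMap.congr_fun this f

end Lower

section Derivations14

variable {k : Type*} [Field k] {t a b p : k} {ht : t ≠ 0}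

local notation "∂" => der (braiding14 t a b p ht)

theorem der_zero_gen_zero_mul (u : T k (Fin 3)) :
    ∂ 0 (gen k 0 * u) = u + t • (gen k 0 * ∂ 0 u) - (t * a) • (gen k 0 * ∂ 2 u) := by
  simp [der_ι_mul, braiding14, r14, R14, Fin.sum_univ_three, finProdFinEquiv]
  abel

theorem der_one_gen_zero_mul (u : T k (Fin 3)) : ∂ 1 (gen k 0 * u) = t • (gen k 0 * ∂ 1 u) := by
  simp [der_ι_mul, braiding14, r14, R14, Fin.sum_univ_three, finProdFinEquiv]

theorem der_two_gen_zero_mul (u : T k (Fin 3)) : ∂ 2 (gen k 0 * u) = t • (gen k 0 * ∂ 2 u) := by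
  simp [der_ι_mul, braiding14, r14, R14, Fin.sum_univ_three, finProdFinEquiv]

theorem der_one_gen_one_mul (u : T k (Fin 3)) :
    ∂ 1 (gen k 1 * u) = u + t • (gen k 1 * ∂ 1 u) := by
  simp [der_ι_mul, braiding14, r14, R14, Fin.sum_univ_three, finProdFinEquiv]

theorem der_two_gen_one_mul (u : T k (Fin 3)) : ∂ 2 (gen k 1 * u) = t • (gen k 1 * ∂ 2 u) := by
  simp [der_ι_mul, braiding14, r14, R14, Fin.sum_univ_three, finProdFinEquiv]

theorem der_zero_gen_two_mul (u : T k (Fin 3)) :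
    ∂ 0 (gen k 2 * u) = t • (gen k 2 * ∂ 0 u) + (t * a) • (gen k 0 * ∂ 0 u) -
      (t * b) • (gen k 2 * ∂ 2 u) + (t * p) • (gen k 1 * ∂ 2 u) -
      (t * a * b) • (gen k 0 * ∂ 2 u) := by
  simp [der_ι_mul, braiding14, r14, R14, Fin.sum_univ_three, finProdFinEquiv]
  abel

theorem der_one_gen_two_mul (u : T k (Fin 3)) :
    ∂ 1 (gen k 2 * u) = t • (gen k 2 * ∂ 1 u) + (t * (2 * b - a)) • (gen k 0 * ∂ 1 u) := by
  simp [der_ι_mul, braiding14, r14, R14, Fin.sum_univ_three, finProdFinEquiv]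
  abel

theorem der_two_gen_two_mul (u : T k (Fin 3)) :
    ∂ 2 (gen k 2 * u) = u + t • (gen k 2 * ∂ 2 u) + (t * b) • (gen k 0 * ∂ 2 u) := by
  simp [der_ι_mul, braiding14, r14, R14, Fin.sum_univ_three, finProdFinEquiv]
  abel

theorem der_two_gen_zero_pow (n : ℕ) : ∂ 2 (gen k 0 ^ n) = 0 := by
  simpa using pow_apply_pow_mul_of_commute der_two_gen_zero_mul 1 n (1 : T k (Fin 3))

theorem der_one_gen_two_pow (n : ℕ) : ∂ 1 (gen k 2 ^ n) = 0 := by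
  induction n with
  | zero => simp
  | succ n ih => simp [pow_succ', der_one_gen_two_mul, ih]

theorem der_zero_pow_gen_zero_pow (N m : ℕ) :
    (∂ 0 ^ N) (gen k 0 ^ m) = qDescFactorial t m N • gen k 0 ^ (m - N) := by
  have skew (n : ℕ) : ∂ 0 (gen k 0 * (gen k 0 ^ n * 1)) =
      gen k 0 ^ n * 1 + t • (gen k 0 * ∂ 0 (gen k 0 ^ n * 1)) := by
    simp [der_zero_gen_zero_mul, der_two_gen_zero_pow]
  simpa using skew_pow_apply_pow_mul skew (der_one _ _) N m

end Derivations14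

section OrderedMonomials

variable {k : Type*} [Field k] {t a b p : k} {ht : t ≠ 0}

local notation "∂" => der (braiding14 t a b p ht)

/-- The monomial `x_1^{e_1} x_2^{e_2} x_3^{e_3}`. -/
def orderedMonomial {A : Type*} [Monoid A] (x : Fin 3 → A) (e : Fin 3 → ℕ) : A :=
  x 0 ^ e 0 * x 1 ^ e 1 * x 2 ^ e 2

theorem der_one_pow_orderedMonomial (N : ℕ) (e : Fin 3 → ℕ) :
    (∂ 1 ^ N) (orderedMonomial (gen k) e) = (t ^ (e 0 * N) * qDescFactorial t (e 1) N) •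
      (gen k 0 ^ e 0 * (gen k 1 ^ (e 1 - N) * gen k 2 ^ e 2)) := by
  rw [orderedMonomial, mul_assoc, pow_apply_pow_mul_of_commute der_one_gen_zero_mul,
    skew_pow_apply_pow_mul (fun _ => der_one_gen_one_mul _) (der_one_gen_two_pow _),
    mul_smul_comm, smul_smul]

/-- Operators `Ψ N`, for `N : ℕ`, that descend to the Nichols algebra and behave like `∂_3 ^ N` on
the monomials in `x_1` and `x_3`. -/
structure IsSeparating (B : Braiding k (Fin 3)) (Ψ : ℕ → Module.End k (T k (Fin 3))) : Prop where
  mem_nicholsIdeal : ∀ N, ∀ u ∈ nicholsIdeal B, Ψ N u ∈ nicholsIdeal B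
  lowersDegree : ∀ N, LowersDegree N (Ψ N)
  apply_gen_zero_pow_mul : ∀ N n m, ∃ s : k, s ≠ 0 ∧
    Ψ N (gen k 0 ^ n * gen k 2 ^ m) = s • (gen k 0 ^ n * Ψ N (gen k 2 ^ m))

theorem pow_apply_mem_nicholsIdeal {B : Braiding k (Fin 3)} {D : Module.End k (T k (Fin 3))}
    (hD : ∀ u ∈ nicholsIdeal B, D u ∈ nicholsIdeal B) (N : ℕ) {u : T k (Fin 3)}
    (hu : u ∈ nicholsIdeal B) : (D ^ N) u ∈ nicholsIdeal B := by
  induction N generalizing u with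
  | zero => exact hu
  | succ N ih => rw [pow_succ, Module.End.mul_apply]; exact ih (hD u hu)

/-- The functional `ε ∂_1^{e_1} Ψ_{e_3} ∂_2^{e_2}`, which extracts a multiple of the coefficient of
the ordered monomial with exponents `e`. -/
noncomputable def monomialFunctional (B : Braiding k (Fin 3))
    (Ψ : ℕ → Module.End k (T k (Fin 3))) (e : Fin 3 → ℕ) : T k (Fin 3) →ₗ[k] k :=
  (counit k (Fin 3)).toLinearMap ∘ₗ ((der B 0 : Module.End k (T k (Fin 3))) ^ e 0 * Ψ (e 2) *
    (der B 1 : Module.End k (T k (Fin 3))) ^ e 1)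

variable {Ψ : ℕ → Module.End k (T k (Fin 3))}

theorem monomialFunctional_eq_zero_of_mem {B : Braiding k (Fin 3)} (hΨ : IsSeparating B Ψ)
    (e : Fin 3 → ℕ) {u : T k (Fin 3)} (hu : u ∈ nicholsIdeal B) :
    monomialFunctional B Ψ e u = 0 :=
  counit_eq_zero <| pow_apply_mem_nicholsIdeal (fun _ => der_mem_nicholsIdeal 0) _ <|
    hΨ.mem_nicholsIdeal _ _ <| pow_apply_mem_nicholsIdeal (fun _ => der_mem_nicholsIdeal 1) _ hu

theorem monomialFunctional_apply_of_lt {e e' : Fin 3 → ℕ} (h : e' 1 < e 1) :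
    monomialFunctional (braiding14 t a b p ht) Ψ e (orderedMonomial (gen k) e') = 0 := by
  simp [monomialFunctional, der_one_pow_orderedMonomial, qDescFactorial_of_lt t h]

theorem exists_monomialFunctional_apply (hΨ : IsSeparating (braiding14 t a b p ht) Ψ)
    {e e' : Fin 3 → ℕ} (h : e' 1 = e 1) :
    ∃ s : k, s ≠ 0 ∧
      monomialFunctional (braiding14 t a b p ht) Ψ e (orderedMonomial (gen k) e') =
        s * qDescFactorial t (e 1) (e 1) *
          counit k (Fin 3) ((∂ 0 ^ e 0) (gen k 0 ^ e' 0 * Ψ (e 2) (gen k 2 ^ e' 2))) := by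
  obtain ⟨s, hs, hmul⟩ := hΨ.apply_gen_zero_pow_mul (e 2) (e' 0) (e' 2)
  refine ⟨t ^ (e' 0 * e 1) * s, mul_ne_zero (pow_ne_zero _ ht) hs, ?_⟩
  simp only [monomialFunctional, LinearMap.comp_apply, Module.End.mul_apply,
    der_one_pow_orderedMonomial, h, Nat.sub_self, pow_zero, one_mul, map_smul, hmul,
    AlgHom.toLinearMap_apply, smul_eq_mul]
  ring

theorem counit_der_zero_pow_gen_zero_pow_mul (hΨ : IsSeparating (braiding14 t a b p ht) Ψ)
    (N m n : ℕ) : counit k (Fin 3) ((∂ 0 ^ N) (gen k 0 ^ m * Ψ n (gen k 2 ^ n))) =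
      if m = N then qDescFactorial t N N * counit k (Fin 3) (Ψ n (gen k 2 ^ n)) else 0 := by
  obtain ⟨r, hr⟩ := (hΨ.lowersDegree n).exists_apply_ι_pow_self 2
  rw [hr, mul_smul_comm, mul_one, map_smul, der_zero_pow_gen_zero_pow]
  rcases lt_trichotomy m N with h | rfl | h
  · simp [qDescFactorial_of_lt t h, h.ne]
  · simp [mul_comm]
  · obtain ⟨l, rfl⟩ := Nat.exists_eq_add_of_lt h
    simp [add_assoc, pow_succ']

theorem mk_eq_zero_iff {A : Type*} [Ring A] [Algebra k A] {I : TwoSidedIdeal A} {u : A} :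
    I.ringCon.mkₐ k u = 0 ↔ u ∈ I := by
  conv_rhs => rw [← TwoSidedIdeal.ker_ringCon_mk' I]
  exact (TwoSidedIdeal.mem_ker _).symm

theorem linearIndependent_orderedMonomial (hΨ : IsSeparating (braiding14 t a b p ht) Ψ)
    {S : Set (Fin 3 → ℕ)} (h0 : ∀ e ∈ S, qDescFactorial t (e 0) (e 0) ≠ 0)
    (h1 : ∀ e ∈ S, qDescFactorial t (e 1) (e 1) ≠ 0)
    (h2 : ∀ e ∈ S, counit k (Fin 3) (Ψ (e 2) (gen k 2 ^ e 2)) ≠ 0) :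
    LinearIndependent k (((nicholsIdeal (braiding14 t a b p ht)).ringCon.mkₐ k).toLinearMap ∘
      fun e : S => orderedMonomial (gen k) e.1) := by
  refine linearIndependent_of_triangular _ _
    (fun e => monomialFunctional (braiding14 t a b p ht) Ψ e.1)
    (fun e => toLex (e.1 1, e.1 2)) (fun e u hu => ?_) (fun e => ?_) fun e e' hne hle => ?_
  · exact monomialFunctional_eq_zero_of_mem hΨ _ ((mk_eq_zero_iff (k := k)).1 hu)
  · obtain ⟨s, hs, happly⟩ := exists_monomialFunctional_apply hΨ (rfl : e.1 1 = e.1 1)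
    rw [happly, counit_der_zero_pow_gen_zero_pow_mul hΨ, if_pos rfl]
    exact mul_ne_zero (mul_ne_zero hs (h1 e e.2)) (mul_ne_zero (h0 e e.2) (h2 e e.2))
  · rcases Prod.Lex.toLex_le_toLex.1 hle with hlt | ⟨(h11 : e'.1 1 = e.1 1), h22⟩
    · exact monomialFunctional_apply_of_lt hlt
    · obtain ⟨s, -, happly⟩ := exists_monomialFunctional_apply hΨ h11
      rw [happly]
      rcases h22.lt_or_eq with hlt | (h22 : e'.1 2 = e.1 2)
      · simp [(hΨ.lowersDegree (e.1 2)).apply_ι_pow_of_lt 2 hlt]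
      · have h00 : e'.1 0 ≠ e.1 0 := fun h00 => hne <| Subtype.ext <| funext fun i => by
          fin_cases i <;> assumption
        rw [h22, counit_der_zero_pow_gen_zero_pow_mul hΨ, if_neg h00, mul_zero]

end OrderedMonomials

section SeparatingOperators

open Polynomial

variable {k : Type*} [Field k]

/-- The projection of the tensor algebra to `k[x_3]` that sends `x_1` and `x_2` to zero. -/
noncomputable def toPoly (k : Type*) [Field k] : T k (Fin 3) →ₐ[k] k[X] :=
  FreeAlgebra.lift k fun i => if i = 2 then X else 0

theorem toPoly_gen (i : Fin 3) : toPoly k (gen k i) = if i = 2 then X else 0 := by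
  simp [toPoly]

theorem counit_eq_coeff_toPoly (u : T k (Fin 3)) :
    counit k (Fin 3) u = (toPoly k u).coeff 0 := by
  have : counit k (Fin 3) = (aeval (0 : k)).comp (toPoly k) := FreeAlgebra.hom_ext <| by
    ext i
    fin_cases i <;> simp [counit, toPoly]
  rw [this, AlgHom.comp_apply, coeff_zero_eq_aeval_zero]

section

variable {t a b p : k} {ht : t ≠ 0}

local notation "∂" => der (braiding14 t a b p ht)

theorem toPoly_der_two (u : T k (Fin 3)) :
    toPoly k (∂ 2 u) = lower 1 (qNat t) (toPoly k u) := by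
  induction u using T_induction with
  | one => simp [lower_one, qNat_zero]
  | mul i u hu =>
    fin_cases i
    · simpa [toPoly_gen] using congrArg (toPoly k) (der_two_gen_zero_mul u)
    · simpa [toPoly_gen] using congrArg (toPoly k) (der_two_gen_one_mul u)
    · change toPoly k (∂ 2 (gen k 2 * u)) = lower 1 (qNat t) (toPoly k (gen k 2 * u))
      simp [der_two_gen_two_mul, toPoly_gen, lower_qNat_X_mul, hu]
  | add u v hu hv => simp only [map_add, hu, hv]
  | smul r u hu => simp only [map_smul, hu]

theorem toPoly_der_two_pow (N : ℕ) (u : T k (Fin 3)) :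
    toPoly k ((∂ 2 ^ N) u) = (lower 1 (qNat t) ^ N) (toPoly k u) :=
  (LinearMap.congr_fun (Module.End.commute_pow_left_of_commute (f := (toPoly k).toLinearMap)
    (LinearMap.ext fun u => (toPoly_der_two u).symm) N) u).symm

theorem isSeparating_der_two_pow : IsSeparating (braiding14 t a b p ht) fun N => ∂ 2 ^ N where
  mem_nicholsIdeal N _ := pow_apply_mem_nicholsIdeal (fun _ => der_mem_nicholsIdeal 2) N
  lowersDegree N := by simpa using (lowersDegree_der _ 2).pow N
  apply_gen_zero_pow_mul N n _ := ⟨t ^ (n * N), pow_ne_zero _ ht,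
    pow_apply_pow_mul_of_commute der_two_gen_zero_mul N n _⟩

theorem counit_der_two_pow_gen_two_pow (N : ℕ) :
    counit k (Fin 3) ((∂ 2 ^ N) (gen k 2 ^ N)) = qDescFactorial t N N := by
  simp [counit_eq_coeff_toPoly, toPoly_der_two_pow, toPoly_gen, lower_pow_X_pow, qDescFactorial]

end

theorem adjoin_induction_mul_left {A : Type*} [Ring A] [Algebra k A] {s : Set A} {p : A → Prop}
    (one : p 1) (mul : ∀ x ∈ s, ∀ u ∈ Algebra.adjoin k s, p u → p (x * u))
    (add : ∀ u v, p u → p v → p (u + v)) (smul : ∀ (r : k) u, p u → p (r • u)) {u : A}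
    (hu : u ∈ Algebra.adjoin k s) : p u := by
  rw [← Subalgebra.mem_toSubmodule, Algebra.adjoin_eq_span] at hu
  induction hu using Submodule.span_induction with
  | mem u hu =>
    induction hu using Submonoid.closure_induction_left with
    | one => exact one
    | mul_left x hx u hu ih => exact mul x hx u (Submonoid.closure_le.2 Algebra.subset_adjoin hu) ih
  | zero => simpa using smul 0 1 one
  | add u v _ _ hu hv => exact add u v hu hv
  | smul r u _ hu => exact smul r u hu

/-- The subalgebra of `T(V)` generated by `x_1` and `x_3`. -/
abbrev oneThree (k : Type*) [Field k] : Subalgebra k (T k (Fin 3)) :=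
  Algebra.adjoin k {gen k 0, gen k 2}

theorem gen_zero_mem_oneThree : gen k 0 ∈ oneThree k := Algebra.subset_adjoin (by simp)

theorem gen_two_mem_oneThree : gen k 2 ∈ oneThree k := Algebra.subset_adjoin (by simp)

@[elab_as_elim]
theorem oneThree_induction {q : T k (Fin 3) → Prop} (one : q 1)
    (gen_zero : ∀ u ∈ oneThree k, q u → q (gen k 0 * u))
    (gen_two : ∀ u ∈ oneThree k, q u → q (gen k 2 * u))
    (add : ∀ u v, q u → q v → q (u + v)) (smul : ∀ (r : k) u, q u → q (r • u)) {u : T k (Fin 3)}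
    (hu : u ∈ oneThree k) : q u :=
  adjoin_induction_mul_left one
    (by rintro x (rfl | rfl); exacts [gen_zero, gen_two]) add smul hu

section

variable {t a b p : k} {ht : t ≠ 0}

local notation "∂" => der (braiding14 t a b p ht)

theorem der_one_eq_zero_of_mem_oneThree {u : T k (Fin 3)} (hu : u ∈ oneThree k) : ∂ 1 u = 0 := by
  refine oneThree_induction ?_ (fun u _ ih => ?_) (fun u _ ih => ?_)
    (fun u v hu hv => ?_) (fun r u hu => ?_) hu
  · exact der_one _ _
  · simp [der_one_gen_zero_mul, ih]
  · simp [der_one_gen_two_mul, ih]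
  · simp [hu, hv]
  · simp [hu]

theorem der_two_mem_oneThree {u : T k (Fin 3)} (hu : u ∈ oneThree k) : ∂ 2 u ∈ oneThree k := by
  refine oneThree_induction ?_ (fun u _ ih => ?_) (fun u hu ih => ?_)
    (fun u v hu hv => ?_) (fun r u hu => ?_) hu
  · simp
  · rw [der_two_gen_zero_mul]
    exact Subalgebra.smul_mem _ (mul_mem gen_zero_mem_oneThree ih) _
  · rw [der_two_gen_two_mul]
    exact add_mem (add_mem hu (Subalgebra.smul_mem _ (mul_mem gen_two_mem_oneThree ih) _))
      (Subalgebra.smul_mem _ (mul_mem gen_zero_mem_oneThree ih) _)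
  · rw [map_add]; exact add_mem hu hv
  · rw [map_smul]; exact Subalgebra.smul_mem _ hu r

end

variable {a b p : k} {ht : (-1 : k) ≠ 0}

local notation "∂" => der (braiding14 (-1) a b p ht)

variable (a b p ht) in
/-- The composition `∂_2 ∂_1` of skew derivations for `t = -1`. -/
noncomputable def derOneZero : Module.End k (T k (Fin 3)) := ∂ 1 * ∂ 0

theorem derOneZero_apply (u : T k (Fin 3)) : derOneZero a b p ht u = ∂ 1 (∂ 0 u) := rfl

theorem derOneZero_gen_zero_mul {u : T k (Fin 3)} (hu : u ∈ oneThree k) :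
    derOneZero a b p ht (gen k 0 * u) = gen k 0 * derOneZero a b p ht u := by
  simp [derOneZero_apply, der_zero_gen_zero_mul, der_one_gen_zero_mul,
    der_one_eq_zero_of_mem_oneThree hu, der_one_eq_zero_of_mem_oneThree (der_two_mem_oneThree hu)]

theorem derOneZero_gen_two_mul {u : T k (Fin 3)} (hu : u ∈ oneThree k) :
    derOneZero a b p ht (gen k 2 * u) = gen k 2 * derOneZero a b p ht u +
      (2 * b) • (gen k 0 * derOneZero a b p ht u) - p • ∂ 2 u := by
  simp only [derOneZero_apply, der_zero_gen_two_mul, der_one_gen_two_mul, der_one_gen_zero_mul,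
    der_one_gen_one_mul, der_one_eq_zero_of_mem_oneThree (der_two_mem_oneThree hu), map_add,
    map_neg, map_smul, neg_smul, one_smul, neg_mul, one_mul, sub_neg_eq_add, neg_sub, neg_add_rev,
    neg_neg, smul_neg, mul_zero, smul_zero, add_zero]
  module

theorem derOneZero_mem_oneThree {u : T k (Fin 3)} (hu : u ∈ oneThree k) :
    derOneZero a b p ht u ∈ oneThree k := by
  refine oneThree_induction ?_ (fun u hu ih => ?_) (fun u hu ih => ?_)
    (fun u v hu hv => ?_) (fun r u hu => ?_) hu
  · simp [derOneZero_apply]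
  · rw [derOneZero_gen_zero_mul hu]
    exact mul_mem gen_zero_mem_oneThree ih
  · rw [derOneZero_gen_two_mul hu]
    exact sub_mem (add_mem (mul_mem gen_two_mem_oneThree ih)
      (Subalgebra.smul_mem _ (mul_mem gen_zero_mem_oneThree ih) _))
      (Subalgebra.smul_mem _ (der_two_mem_oneThree hu) _)
  · rw [map_add]; exact add_mem hu hv
  · rw [map_smul]; exact Subalgebra.smul_mem _ hu r

theorem toPoly_derOneZero {u : T k (Fin 3)} (hu : u ∈ oneThree k) :
    toPoly k (derOneZero a b p ht u) = lower 2 (fun n => -p * (n / 2 : ℕ)) (toPoly k u) := by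
  refine oneThree_induction ?_ (fun u hu _ => ?_) (fun u hu ih => ?_)
    (fun u v hu hv => ?_) (fun r u hu => ?_) hu
  · simp [derOneZero_apply, lower_one]
  · simp [derOneZero_gen_zero_mul hu, toPoly_gen]
  · rw [derOneZero_gen_two_mul hu, map_mul, toPoly_gen, if_pos rfl, lower_half_X_mul, ← ih]
    simp [toPoly_gen, toPoly_der_two]
  · simp only [map_add, hu, hv]
  · simp only [map_smul, hu]

theorem derOneZero_gen_zero_pow_mul (n : ℕ) {u : T k (Fin 3)} (hu : u ∈ oneThree k) :
    derOneZero a b p ht (gen k 0 ^ n * u) = gen k 0 ^ n * derOneZero a b p ht u := by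
  induction n with
  | zero => simp
  | succ n ih =>
    rw [pow_succ', mul_assoc, derOneZero_gen_zero_mul
      (mul_mem (pow_mem gen_zero_mem_oneThree n) hu), ih, mul_assoc]

theorem derOneZero_pow_gen_zero_pow_mul (N n : ℕ) {u : T k (Fin 3)} (hu : u ∈ oneThree k) :
    (derOneZero a b p ht ^ N) (gen k 0 ^ n * u) = gen k 0 ^ n * (derOneZero a b p ht ^ N) u := by
  induction N generalizing u with
  | zero => rfl
  | succ N ih =>
    rw [pow_succ, Module.End.mul_apply, derOneZero_gen_zero_pow_mul n hu,
      ih (derOneZero_mem_oneThree hu), Module.End.mul_apply]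

theorem toPoly_derOneZero_pow (N : ℕ) {u : T k (Fin 3)} (hu : u ∈ oneThree k) :
    toPoly k ((derOneZero a b p ht ^ N) u) =
      (lower 2 (fun n => -p * (n / 2 : ℕ)) ^ N) (toPoly k u) := by
  induction N generalizing u with
  | zero => rfl
  | succ N ih =>
    rw [pow_succ, Module.End.mul_apply, ih (derOneZero_mem_oneThree hu), toPoly_derOneZero hu,
      pow_succ, Module.End.mul_apply]

/-- If `p` is nonzero, then so is `∂_2 ∂_1 x_3²`, and powers of `∂_2 ∂_1` reach the even powers of
`x_3` that `∂_3` cannot separate because `∂_3²` kills them. -/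
theorem isSeparating_derOneZero : IsSeparating (braiding14 (-1) a b p ht)
    fun N => ∂ 2 ^ (N % 2) * derOneZero a b p ht ^ (N / 2) where
  mem_nicholsIdeal N u hu := pow_apply_mem_nicholsIdeal (fun _ => der_mem_nicholsIdeal 2) _ <|
    pow_apply_mem_nicholsIdeal
      (D := derOneZero a b p ht) (fun _ hu => der_mem_nicholsIdeal 1 (der_mem_nicholsIdeal 0 hu))
      _ hu
  lowersDegree N := by
    have lowers (i : Fin 3) := lowersDegree_der (braiding14 (-1) a b p ht) i
    have := ((lowers 2).pow (N % 2)).mul (((lowers 1).mul (lowers 0)).pow (N / 2))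
    rwa [one_mul, one_add_one_eq_two, Nat.mod_add_div] at this
  apply_gen_zero_pow_mul N n m := ⟨(-1) ^ (n * (N % 2)), pow_ne_zero _ ht, by
    rw [Module.End.mul_apply, derOneZero_pow_gen_zero_pow_mul _ _ (pow_mem gen_two_mem_oneThree m),
      pow_apply_pow_mul_of_commute der_two_gen_zero_mul, Module.End.mul_apply]⟩

theorem counit_derOneZero_gen_two_pow_ne_zero [CharZero k] (hp : p ≠ 0) (N : ℕ) :
    counit k (Fin 3) ((∂ 2 ^ (N % 2) * derOneZero a b p ht ^ (N / 2)) (gen k 2 ^ N)) ≠ 0 := by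
  rw [counit_eq_coeff_toPoly, Module.End.mul_apply, toPoly_der_two_pow,
    toPoly_derOneZero_pow _ (pow_mem gen_two_mem_oneThree N), map_pow, toPoly_gen, if_pos rfl,
    lower_pow_X_pow, map_smul, lower_pow_X_pow]
  have half_ne_zero : ∀ i ∈ Finset.range (N / 2), -p * (((N - 2 * i) / 2 : ℕ) : k) ≠ 0 := by
    intro i hi
    have : (N - 2 * i) / 2 ≠ 0 := by rw [Finset.mem_range] at hi; omega
    exact mul_ne_zero (neg_ne_zero.2 hp) (Nat.cast_ne_zero.2 this)
  have exponent_eq : N - 2 * (N / 2) = N % 2 := by omega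
  rw [exponent_eq, one_mul, Nat.sub_self, pow_zero, coeff_smul, coeff_smul]
  simp only [smul_eq_mul, coeff_one_zero, mul_one, one_mul]
  exact mul_ne_zero (Finset.prod_ne_zero_iff.2 half_ne_zero)
    (qDescFactorial_self_ne_zero_of_lt_two (-1) (Nat.mod_lt N two_pos))

end SeparatingOperators

section Straightening

variable {k A : Type*} [Field k] [Ring A] [Algebra k A] {x : Fin 3 → A} {S : Set (Fin 3 → ℕ)}

/-- The exponents in `S` of total degree at most `n`. -/
def degreeLE (S : Set (Fin 3 → ℕ)) (n : ℕ) : Set (Fin 3 → ℕ) := {e | e ∈ S ∧ ∑ i, e i ≤ n}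

/-- The span of the ordered monomials in `x` of degree at most `n` with exponents in `S`. -/
def monomialFiltration (k : Type*) [Field k] [Algebra k A] (x : Fin 3 → A)
    (S : Set (Fin 3 → ℕ)) (n : ℕ) : Submodule k A :=
  Submodule.span k (orderedMonomial x '' degreeLE S n)

theorem orderedMonomial_mem_monomialFiltration {e : Fin 3 → ℕ} {n : ℕ} (he : e ∈ S)
    (hn : ∑ i, e i ≤ n) : orderedMonomial x e ∈ monomialFiltration k x S n :=
  Submodule.subset_span ⟨e, ⟨he, hn⟩, rfl⟩

theorem one_mem_monomialFiltration (h0 : 0 ∈ S) (n : ℕ) : (1 : A) ∈ monomialFiltration k x S n := by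
  simpa [orderedMonomial] using orderedMonomial_mem_monomialFiltration (x := x) (k := k) h0
    (by simp : ∑ i, (0 : Fin 3 → ℕ) i ≤ n)

theorem monomialFiltration_mono (x : Fin 3 → A) (S : Set (Fin 3 → ℕ)) :
    Monotone (monomialFiltration k x S) := fun _ _ h =>
  Submodule.span_mono (Set.image_mono fun _ he => ⟨he.1, he.2.trans h⟩)

/-- Left multiplication with the `x_i` raises the degree of ordered monomials by at most one. -/
def IsStraightening (k : Type*) [Field k] [Algebra k A] (x : Fin 3 → A)
    (S : Set (Fin 3 → ℕ)) : Prop :=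
  ∀ q, ∀ e ∈ S, x q * orderedMonomial x e ∈ monomialFiltration k x S (∑ i, e i + 1)

theorem IsStraightening.mul_mem (h : IsStraightening k x S) (q : Fin 3) {n : ℕ} {u : A}
    (hu : u ∈ monomialFiltration k x S n) : x q * u ∈ monomialFiltration k x S (n + 1) := by
  refine (Submodule.span_le
    (p := (monomialFiltration k x S (n + 1)).comap (LinearMap.mulLeft k (x q)))).2 ?_ hu
  rintro _ ⟨e, he, rfl⟩
  exact monomialFiltration_mono x S (Nat.succ_le_succ he.2) (h q e he.1)

theorem IsStraightening.exists_mem (h : IsStraightening k x S) (h0 : 0 ∈ S)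
    (hx : Algebra.adjoin k (Set.range x) = ⊤) (u : A) : ∃ n, u ∈ monomialFiltration k x S n := by
  have hu : u ∈ Algebra.adjoin k (Set.range x) := hx ▸ Algebra.mem_top
  refine adjoin_induction_mul_left (p := fun u => ∃ n, u ∈ monomialFiltration k x S n)
    ⟨0, one_mem_monomialFiltration h0 0⟩ ?_ ?_ ?_ hu
  · rintro _ ⟨q, rfl⟩ v - ⟨n, hn⟩
    exact ⟨n + 1, h.mul_mem q hn⟩
  · rintro v w ⟨n, hn⟩ ⟨m, hm⟩
    exact ⟨max n m, add_mem (monomialFiltration_mono _ _ (le_max_left _ _) hn)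
      (monomialFiltration_mono _ _ (le_max_right _ _) hm)⟩
  · rintro r v ⟨n, hn⟩
    exact ⟨n, Submodule.smul_mem _ r hn⟩

theorem IsStraightening.span_eq_top (h : IsStraightening k x S) (h0 : 0 ∈ S)
    (hx : Algebra.adjoin k (Set.range x) = ⊤) :
    Submodule.span k (Set.range fun e : S => orderedMonomial x e) = ⊤ := by
  refine Submodule.eq_top_iff'.2 fun u => ?_
  obtain ⟨n, hn⟩ := h.exists_mem h0 hx u
  refine Submodule.span_mono ?_ hn
  rintro _ ⟨e, he, rfl⟩
  exact ⟨⟨e, he.1⟩, rfl⟩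

theorem zero_mul_orderedMonomial (x : Fin 3 → A) (e : Fin 3 → ℕ) :
    x 0 * orderedMonomial x e = orderedMonomial x (e + Pi.single 0 1) := by
  simp [orderedMonomial, pow_succ', mul_assoc]

/-- The commutation relations common to all quadratic Nichols algebras attached to `R_{1,4}`, with
`c = t` and `d = a - 2b`. For `t = -1` the term with `x 0 ^ 2` is absent. -/
structure SkewCommutes (x : Fin 3 → A) (c a d : k) : Prop where
  one_mul_zero : x 1 * x 0 = c • (x 0 * x 1)
  two_mul_zero : x 2 * x 0 = c • (x 0 * x 2) + a • x 0 ^ 2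
  two_mul_one : x 2 * x 1 = c • (x 1 * x 2) - d • (x 0 * x 1)

namespace SkewCommutes

variable {c a d : k}

theorem one_mul_zero_pow (h : SkewCommutes x c a d) (i : ℕ) :
    x 1 * x 0 ^ i = c ^ i • (x 0 ^ i * x 1) := by
  induction i with
  | zero => simp
  | succ i ih =>
    rw [pow_succ, ← mul_assoc, ih, smul_mul_assoc, mul_assoc, h.one_mul_zero, mul_smul_comm,
      smul_smul, ← pow_succ, mul_assoc]

theorem one_pow_mul_zero (h : SkewCommutes x c a d) (j : ℕ) :
    x 1 ^ j * x 0 = c ^ j • (x 0 * x 1 ^ j) := by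
  induction j with
  | zero => simp
  | succ j ih =>
    rw [pow_succ', mul_assoc, ih, mul_smul_comm, ← mul_assoc, h.one_mul_zero, smul_mul_assoc,
      smul_smul, ← pow_succ, mul_assoc]

theorem two_mul_zero_pow (h : SkewCommutes x c a d) (i : ℕ) :
    x 2 * x 0 ^ i = c ^ i • (x 0 ^ i * x 2) + (a * qNat c i) • x 0 ^ (i + 1) := by
  induction i with
  | zero => simp [qNat_zero]
  | succ i ih =>
    have last : x 2 * x 0 ^ (i + 1) =
        c ^ i • (x 0 ^ i * (x 2 * x 0)) + (a * qNat c i) • (x 0 ^ (i + 1) * x 0) := by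
      rw [pow_succ, ← mul_assoc, ih, add_mul, smul_mul_assoc, smul_mul_assoc, mul_assoc, pow_succ]
    rw [last, h.two_mul_zero, qNat_succ_right]
    simp only [mul_add, mul_smul_comm, ← mul_assoc, ← pow_add, ← pow_succ]
    module

theorem two_mul_one_pow (h : SkewCommutes x c a d) (j : ℕ) :
    x 2 * x 1 ^ j = c ^ j • (x 1 ^ j * x 2) - (d * qNat (c ^ 2) j) • (x 0 * x 1 ^ j) := by
  induction j with
  | zero => simp [qNat_zero]
  | succ j ih =>
    have last : x 2 * x 1 ^ (j + 1) =
        c ^ j • (x 1 ^ j * (x 2 * x 1)) - (d * qNat (c ^ 2) j) • (x 0 * x 1 ^ (j + 1)) := by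
      rw [pow_succ, ← mul_assoc, ih, sub_mul, smul_mul_assoc, smul_mul_assoc, mul_assoc, mul_assoc]
    rw [last, h.two_mul_one, qNat_succ_right]
    simp only [mul_sub, mul_smul_comm, ← mul_assoc, h.one_pow_mul_zero, smul_mul_assoc, pow_succ]
    module

theorem one_mul_orderedMonomial (h : SkewCommutes x c a d) (e : Fin 3 → ℕ) :
    x 1 * orderedMonomial x e = c ^ e 0 • orderedMonomial x (e + Pi.single 1 1) := by
  simp [orderedMonomial, pow_succ', ← mul_assoc, h.one_mul_zero_pow]

theorem two_mul_orderedMonomial (h : SkewCommutes x c a d) (e : Fin 3 → ℕ) :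
    x 2 * orderedMonomial x e = (c ^ e 0 * c ^ e 1) • orderedMonomial x (e + Pi.single 2 1) +
      (a * qNat c (e 0) - c ^ e 0 * (d * qNat (c ^ 2) (e 1))) •
        orderedMonomial x (e + Pi.single 0 1) := by
  have e0 : orderedMonomial x (e + Pi.single 0 1) = x 0 ^ (e 0 + 1) * x 1 ^ e 1 * x 2 ^ e 2 := by
    simp [orderedMonomial]
  have e2 : orderedMonomial x (e + Pi.single 2 1) = x 0 ^ e 0 * x 1 ^ e 1 * x 2 ^ (e 2 + 1) := by
    simp [orderedMonomial]
  rw [e0, e2, orderedMonomial, ← mul_assoc, ← mul_assoc, h.two_mul_zero_pow, add_mul,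
    smul_mul_assoc, mul_assoc _ (x 2), h.two_mul_one_pow, pow_succ' (x 2), pow_succ (x 0)]
  simp only [mul_sub, sub_mul, add_mul, mul_assoc, mul_smul_comm, smul_mul_assoc]
  module

theorem isStraightening (h : SkewCommutes x c a d)
    (raise_mem : ∀ q, ∀ e ∈ S,
      orderedMonomial x (e + Pi.single q 1) ∈ monomialFiltration k x S (∑ i, e i + 1)) :
    IsStraightening k x S := by
  intro q e he
  fin_cases q
  · exact zero_mul_orderedMonomial x e ▸ raise_mem 0 e he
  · exact h.one_mul_orderedMonomial e ▸ Submodule.smul_mem _ _ (raise_mem 1 e he)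
  · exact h.two_mul_orderedMonomial e ▸ add_mem (Submodule.smul_mem _ _ (raise_mem 2 e he))
      (Submodule.smul_mem _ _ (raise_mem 0 e he))

end SkewCommutes

theorem mem_B₀_iff {e : Fin 3 → ℕ} : e ∈ B₀ ↔ e ∈ B₁ ∧ e 2 < 2 := by
  simp [B₀, B₁, Fin.forall_fin_succ, and_assoc]

theorem sum_add_single (e : Fin 3 → ℕ) (q : Fin 3) :
    ∑ i, (e + Pi.single q 1 : Fin 3 → ℕ) i = ∑ i, e i + 1 := by
  simp [Finset.sum_add_distrib]

theorem raise_mem_of_mem {q : Fin 3} {e : Fin 3 → ℕ} (he : e + Pi.single q 1 ∈ S) :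
    orderedMonomial x (e + Pi.single q 1) ∈ monomialFiltration k x S (∑ i, e i + 1) :=
  orderedMonomial_mem_monomialFiltration he (sum_add_single e q).le

theorem orderedMonomial_eq_zero (h00 : x 0 ^ 2 = 0) (h11 : x 1 ^ 2 = 0) {e : Fin 3 → ℕ}
    (he : e ∉ B₁) : orderedMonomial x e = 0 := by
  have : 2 ≤ e 0 ∨ 2 ≤ e 1 := by
    simpa only [B₁, Set.mem_ofPred_eq, not_and_or, not_lt] using he
  rcases this with h | h
  · simp [orderedMonomial, pow_eq_zero_of_le h h00]
  · simp [orderedMonomial, pow_eq_zero_of_le h h11]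

theorem raise_mem_of_sq_eq_zero (h00 : x 0 ^ 2 = 0) (h11 : x 1 ^ 2 = 0) {q : Fin 3}
    {e : Fin 3 → ℕ} (he : e + Pi.single q 1 ∈ B₁ → e + Pi.single q 1 ∈ S) :
    orderedMonomial x (e + Pi.single q 1) ∈ monomialFiltration k x S (∑ i, e i + 1) := by
  by_cases hB : e + Pi.single q 1 ∈ B₁
  · exact raise_mem_of_mem (he hB)
  · exact orderedMonomial_eq_zero h00 h11 hB ▸ zero_mem _

namespace SkewCommutes

variable {c a d : k}

theorem isStraightening_B₃ (h : SkewCommutes x c a d) : IsStraightening k x B₃ :=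
  h.isStraightening fun _ _ _ => raise_mem_of_mem trivial

theorem isStraightening_B₁ (h : SkewCommutes x c a d) (h00 : x 0 ^ 2 = 0) (h11 : x 1 ^ 2 = 0) :
    IsStraightening k x B₁ :=
  h.isStraightening fun _ _ _ => raise_mem_of_sq_eq_zero h00 h11 id

theorem orderedMonomial_add_single_two (h : SkewCommutes x c a d) {b : k}
    (h22 : x 2 ^ 2 = b • (x 0 * x 2)) {e : Fin 3 → ℕ} (he : e 2 = 1) :
    orderedMonomial x (e + Pi.single 2 1) =
      (b * c ^ e 1) • orderedMonomial x (e + Pi.single 0 1) := by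
  simp [orderedMonomial, he, h22, ← mul_assoc, mul_assoc _ _ (x 0), h.one_pow_mul_zero, pow_succ,
    smul_smul]

theorem isStraightening_B₀ (h : SkewCommutes x c a d) (h00 : x 0 ^ 2 = 0) (h11 : x 1 ^ 2 = 0)
    {b : k} (h22 : x 2 ^ 2 = b • (x 0 * x 2)) : IsStraightening k x B₀ := by
  refine h.isStraightening fun q e he => ?_
  have raise {q : Fin 3} (hq : (e + Pi.single q 1 : Fin 3 → ℕ) 2 < 2) :
      orderedMonomial x (e + Pi.single q 1) ∈ monomialFiltration k x B₀ (∑ i, e i + 1) :=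
    raise_mem_of_sq_eq_zero h00 h11 fun hB => mem_B₀_iff.2 ⟨hB, hq⟩
  by_cases hq : (e + Pi.single q 1 : Fin 3 → ℕ) 2 < 2
  · exact raise hq
  · have he2 : e 2 < 2 := he 2
    obtain rfl : q = 2 := by
      by_contra hne
      simp [Ne.symm hne, he2] at hq
    have he2 : e 2 = 1 := by
      simp only [Pi.add_apply, Pi.single_eq_same] at hq
      omega
    rw [h.orderedMonomial_add_single_two h22 he2]
    exact Submodule.smul_mem _ _ (raise (by simp [he2]))

end SkewCommutes

end Straightening

section Presentation

variable {k A : Type*} [Field k] [Ring A] [Algebra k A] {a b : k} {π : T k (Fin 3) →ₐ[k] A}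

theorem isStraightening_of_relSym (hπ : ∀ r ∈ relSym a b, π r = 0) :
    IsStraightening k (π ∘ gen k) B₃ := by
  simp only [relSym, Set.mem_insert_iff, Set.mem_singleton_iff, forall_eq_or_imp, forall_eq,
    map_add, map_sub, map_mul, map_smul, map_pow] at hπ
  obtain ⟨h10, h20, h21⟩ := hπ
  have h : SkewCommutes (π ∘ gen k) 1 a (a - 2 * b) := by
    constructor <;> rw [← sub_eq_zero, Function.comp, one_smul]
    exacts [h10, by rw [← h20]; abel, by rw [← h21]; abel]
  exact h.isStraightening_B₃

theorem skewCommutes_of_relExt (hπ : ∀ r ∈ relExt a b, π r = 0) :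
    SkewCommutes (π ∘ gen k) (-1) 0 (a - 2 * b) := by
  simp only [relExt, Set.mem_insert_iff, Set.mem_singleton_iff, forall_eq_or_imp, forall_eq,
    map_add, map_mul, map_smul, map_pow] at hπ
  obtain ⟨h10, h20, h21, -⟩ := hπ
  constructor <;> rw [← sub_eq_zero, Function.comp, neg_one_smul]
  exacts [by rw [← h10]; abel, by rw [← h20, zero_smul]; abel, by rw [← h21]; abel]

theorem sq_eq_zero_of_relExt (hπ : ∀ r ∈ relExt a b, π r = 0) :
    π (gen k 0) ^ 2 = 0 ∧ π (gen k 1) ^ 2 = 0 := by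
  simp only [← map_pow]
  exact ⟨hπ _ (by simp [relExt]), hπ _ (by simp [relExt])⟩

theorem isStraightening_of_relExt (hπ : ∀ r ∈ relExt a b, π r = 0) :
    IsStraightening k (π ∘ gen k) B₁ :=
  (skewCommutes_of_relExt hπ).isStraightening_B₁ (sq_eq_zero_of_relExt hπ).1
    (sq_eq_zero_of_relExt hπ).2

theorem isStraightening_of_relFin (hπ : ∀ r ∈ relFin a b, π r = 0) :
    IsStraightening k (π ∘ gen k) B₀ := by
  have hExt : ∀ r ∈ relExt a b, π r = 0 := fun r hr => hπ r (relExt_subset_relFin a b hr)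
  have h22 : π (gen k 2 ^ 2 - b • (gen k 0 * gen k 2)) = 0 := hπ _ (by simp [relFin])
  rw [map_sub, map_smul, map_mul, map_pow, sub_eq_zero] at h22
  exact (skewCommutes_of_relExt hExt).isStraightening_B₀ (sq_eq_zero_of_relExt hExt).1
    (sq_eq_zero_of_relExt hExt).2 h22

theorem adjoin_range_comp_gen (hπ : Function.Surjective π) :
    Algebra.adjoin k (Set.range (π ∘ gen k)) = ⊤ := by
  rw [Set.range_comp, ← AlgHom.map_adjoin, FreeAlgebra.adjoin_range_ι, Algebra.map_top,
    (AlgHom.range_eq_top π).2 hπ]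

theorem map_orderedMonomial (π : T k (Fin 3) →ₐ[k] A) (e : Fin 3 → ℕ) :
    π (orderedMonomial (gen k) e) = orderedMonomial (π ∘ gen k) e := by
  simp [orderedMonomial]

theorem ker_le_ker_of_span_of_linearIndependent {M N N' I : Type*} [AddCommGroup M] [Module k M]
    [AddCommGroup N] [Module k N] [AddCommGroup N'] [Module k N'] {f : M →ₗ[k] N} {g : M →ₗ[k] N'}
    (hle : LinearMap.ker f ≤ LinearMap.ker g) {v : I → M}
    (hspan : Submodule.span k (Set.range (f ∘ v)) = ⊤) (hind : LinearIndependent k (g ∘ v)) :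
    LinearMap.ker g ≤ LinearMap.ker f := by
  intro u hu
  have hfu : f u ∈ Submodule.span k (Set.range (f ∘ v)) := hspan ▸ Submodule.mem_top
  obtain ⟨c, hc⟩ := (Finsupp.range_linearCombination k (v := f ∘ v)).ge hfu
  rw [← Finsupp.apply_linearCombination] at hc
  have hsub : u - Finsupp.linearCombination k v c ∈ LinearMap.ker g := hle (by simp [hc])
  have hgc : Finsupp.linearCombination k (g ∘ v) c = 0 := by
    rw [← Finsupp.apply_linearCombination]
    simpa using sub_mem hu hsub
  rw [LinearMap.mem_ker, ← hc, linearIndependent_iff.1 hind c hgc, map_zero, map_zero]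

end Presentation

section Nichols

variable {k : Type*} [Field k] {B : Braiding k (Fin 3)} {S : Set (Fin 3 → ℕ)}

theorem nicholsIdeal_eq_span {G : Set (T k (Fin 3))} (hG : G ⊆ nicholsIdeal B)
    (h0 : 0 ∈ S) (hst : IsStraightening k ((TwoSidedIdeal.span G).ringCon.mkₐ k ∘ gen k) S)
    (hind : LinearIndependent k
      (((nicholsIdeal B).ringCon.mkₐ k).toLinearMap ∘ fun e : S => orderedMonomial (gen k) e.1)) :
    nicholsIdeal B = TwoSidedIdeal.span G := by
  set π := (TwoSidedIdeal.span G).ringCon.mkₐ k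
  set ρ := (nicholsIdeal B).ringCon.mkₐ k
  have hle : TwoSidedIdeal.span G ≤ nicholsIdeal B := TwoSidedIdeal.span_le.2 hG
  have hspan := hst.span_eq_top h0 (adjoin_range_comp_gen (RingCon.mkₐ_surjective (α := k) _))
  simp only [← map_orderedMonomial] at hspan
  have hker : LinearMap.ker ρ.toLinearMap ≤ LinearMap.ker π.toLinearMap :=
    ker_le_ker_of_span_of_linearIndependent
      (fun _ hu => (mk_eq_zero_iff (k := k)).2 (hle ((mk_eq_zero_iff (k := k)).1 hu))) hspan hind
  exact le_antisymm
    (fun _ hu => (mk_eq_zero_iff (k := k)).1 (hker ((mk_eq_zero_iff (k := k)).2 hu))) hle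

theorem isMonomialBasis_of_isStraightening (h0 : 0 ∈ S)
    (hst : IsStraightening k ((nicholsIdeal B).ringCon.mkₐ k ∘ gen k) S)
    (hind : LinearIndependent k
      (((nicholsIdeal B).ringCon.mkₐ k).toLinearMap ∘ fun e : S => orderedMonomial (gen k) e.1)) :
    IsMonomialBasis B S := by
  refine ⟨?_, hst.span_eq_top h0 (adjoin_range_comp_gen (RingCon.mkₐ_surjective (α := k) _))⟩
  convert hind using 2 with e
  exact (map_orderedMonomial ((nicholsIdeal B).ringCon.mkₐ k) e.1).symm

end Nichols

section Growth

open Filter Topology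

variable {k A : Type*} [Field k] [Ring A] [Algebra k A]

theorem tendsto_log_mul_pow_div_log {C : ℝ} (hC : 0 < C) (g : ℕ) :
    Tendsto (fun n : ℕ => ((Real.log (C * (n : ℝ) ^ g) / Real.log n : ℝ) : EReal)) atTop
      (𝓝 (g : EReal)) := by
  have hconst : Tendsto (fun n : ℕ => Real.log C / Real.log n) atTop (𝓝 0) :=
    tendsto_const_nhds.div_atTop (Real.tendsto_log_atTop.comp tendsto_natCast_atTop_atTop)
  have hlog : Tendsto (fun n : ℕ => Real.log (C * (n : ℝ) ^ g) / Real.log n) atTop (𝓝 (g : ℝ)) := by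
    rw [← zero_add (g : ℝ)]
    refine (hconst.add_const (g : ℝ)).congr' ?_
    filter_upwards [eventually_gt_atTop 1] with n hn
    have hn1 : (1 : ℝ) < n := by exact_mod_cast hn
    have hpos := Real.log_pos hn1
    rw [Real.log_mul hC.ne' (by positivity), Real.log_pow]
    field_simp
  exact_mod_cast (continuous_coe_real_ereal.tendsto _).comp hlog

theorem gkDim_le {g : ℕ}
    (h : ∀ W : Submodule k A, W.FG → ∃ C : ℝ, ∀ n : ℕ, 1 ≤ n →
      (Module.finrank k ((1 ⊔ W) ^ n : Submodule k A) : ℝ) ≤ C * (n : ℝ) ^ g) :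
    gkDim k A ≤ g := by
  refine iSup_le fun W => ?_
  obtain ⟨C, hW⟩ := h W.1 W.2
  rw [← (tendsto_log_mul_pow_div_log (lt_max_of_lt_right one_pos : 0 < max C 1) g).limsup_eq]
  refine limsup_le_limsup ?_
  filter_upwards [eventually_ge_atTop 1] with n hn
  have hn1 : (1 : ℝ) ≤ n := by exact_mod_cast hn
  have hng : (1 : ℝ) ≤ (n : ℝ) ^ g := one_le_pow₀ hn1
  rw [EReal.coe_le_coe_iff]
  refine div_le_div_of_nonneg_right ?_ (Real.log_nonneg hn1)
  rcases Nat.eq_zero_or_pos (Module.finrank k ((1 ⊔ W.1) ^ n : Submodule k A)) with h0 | h0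
  · rw [h0, Nat.cast_zero, Real.log_zero]
    exact Real.log_nonneg (one_le_mul_of_one_le_of_one_le (le_max_right _ _) hng)
  · refine Real.log_le_log (by exact_mod_cast h0) ((hW n hn).trans ?_)
    exact mul_le_mul_of_nonneg_right (le_max_left _ _) (by positivity)

theorem le_gkDim {g : ℕ} {W : Submodule k A} (hW : W.FG) {C : ℝ} (hC : 0 < C)
    (h : ∀ n : ℕ, C * (n : ℝ) ^ g ≤ Module.finrank k ((1 ⊔ W) ^ n : Submodule k A)) :
    g ≤ gkDim k A := by
  refine le_iSup_of_le ⟨W, hW⟩ ?_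
  rw [← (tendsto_log_mul_pow_div_log hC g).limsup_eq]
  refine limsup_le_limsup ?_
  filter_upwards [eventually_ge_atTop 1] with n hn
  have hn1 : (1 : ℝ) ≤ n := by exact_mod_cast hn
  rw [EReal.coe_le_coe_iff]
  exact div_le_div_of_nonneg_right (Real.log_le_log (by positivity) (h n)) (Real.log_nonneg hn1)

variable {x : Fin 3 → A} {S : Set (Fin 3 → ℕ)}

theorem le_of_mem_degreeLE {n : ℕ} {e : Fin 3 → ℕ} (he : e ∈ degreeLE S n) (i : Fin 3) :
    e i ≤ n :=
  (Finset.single_le_sum (fun _ _ => Nat.zero_le _) (Finset.mem_univ i)).trans he.2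

theorem finite_degreeLE (S : Set (Fin 3 → ℕ)) (n : ℕ) : (degreeLE S n).Finite :=
  (Set.finite_Iic fun _ : Fin 3 => n).subset fun _ he => le_of_mem_degreeLE he

theorem monomialFiltration_fg (k : Type*) [Field k] [Algebra k A] (x : Fin 3 → A)
    (S : Set (Fin 3 → ℕ)) (n : ℕ) : (monomialFiltration k x S n).FG :=
  Submodule.fg_span ((finite_degreeLE S n).image _)

theorem finrank_monomialFiltration_le (x : Fin 3 → A) (S : Set (Fin 3 → ℕ)) (n : ℕ) :
    Module.finrank k (monomialFiltration k x S n) ≤ (degreeLE S n).ncard := by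
  have := ((finite_degreeLE S n).image (orderedMonomial x)).fintype
  refine (finrank_span_le_card (R := k) _).trans ?_
  rw [← Set.ncard_eq_toFinset_card']
  exact Set.ncard_image_le (finite_degreeLE S n)

theorem finrank_monomialFiltration (hli : LinearIndependent k fun e : S => orderedMonomial x e)
    (n : ℕ) : Module.finrank k (monomialFiltration k x S n) = (degreeLE S n).ncard := by
  have := (finite_degreeLE S n).fintype
  have h : LinearIndependent k fun e : degreeLE S n => orderedMonomial x e :=
    hli.comp (Set.inclusion fun _ he => he.1) (Set.inclusion_injective _)
  rw [monomialFiltration, Set.image_eq_range, finrank_span_eq_card h, ← Nat.card_eq_fintype_card,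
    Nat.card_coe_set_eq]

theorem IsStraightening.pow_mul_mem (h : IsStraightening k x S) (q : Fin 3) (i : ℕ) {n : ℕ} {u : A}
    (hu : u ∈ monomialFiltration k x S n) : x q ^ i * u ∈ monomialFiltration k x S (n + i) := by
  induction i with
  | zero => simpa
  | succ i ih => exact pow_succ' (x q) i ▸ mul_assoc (x q) _ u ▸ h.mul_mem q ih

theorem IsStraightening.mul_mem_monomialFiltration (h : IsStraightening k x S) {m n : ℕ} {u v : A}
    (hu : u ∈ monomialFiltration k x S m) (hv : v ∈ monomialFiltration k x S n) :
    u * v ∈ monomialFiltration k x S (m + n) := by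
  refine (Submodule.span_le
    (p := (monomialFiltration k x S (m + n)).comap (LinearMap.mulRight k v))).2 ?_ hu
  rintro _ ⟨e, ⟨-, hm⟩, rfl⟩
  rw [Fin.sum_univ_three] at hm
  rw [SetLike.mem_coe, Submodule.mem_comap, LinearMap.mulRight_apply, orderedMonomial, mul_assoc,
    mul_assoc]
  exact monomialFiltration_mono x S (by omega)
    (h.pow_mul_mem 0 _ (h.pow_mul_mem 1 _ (h.pow_mul_mem 2 _ hv)))

theorem IsStraightening.pow_le (h : IsStraightening k x S) (h0 : 0 ∈ S) {W : Submodule k A}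
    {d : ℕ} (hW : W ≤ monomialFiltration k x S d) (n : ℕ) :
    (1 ⊔ W) ^ n ≤ monomialFiltration k x S (d * n) := by
  have hone : 1 ⊔ W ≤ monomialFiltration k x S d :=
    sup_le (Submodule.one_le.2 (one_mem_monomialFiltration h0 d)) hW
  induction n with
  | zero => exact (pow_zero (1 ⊔ W)).trans_le (Submodule.one_le.2 (one_mem_monomialFiltration h0 _))
  | succ n ih =>
    rw [pow_succ]
    exact Submodule.mul_le.2 fun u hu v hv => h.mul_mem_monomialFiltration (ih hu) (hone hv)

theorem IsStraightening.exists_le_monomialFiltration (h : IsStraightening k x S) (h0 : 0 ∈ S)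
    (hx : Algebra.adjoin k (Set.range x) = ⊤) {W : Submodule k A} (hW : W.FG) :
    ∃ d, W ≤ monomialFiltration k x S d := by
  choose d hd using h.exists_mem h0 hx
  obtain ⟨s, rfl⟩ := hW
  exact ⟨s.sup d, Submodule.span_le.2 fun u hu =>
    monomialFiltration_mono x S (Finset.le_sup hu) (hd u)⟩

theorem monomialFiltration_le_pow (n : ℕ) :
    monomialFiltration k x S n ≤ (1 ⊔ Submodule.span k (Set.range x)) ^ n := by
  set W := 1 ⊔ Submodule.span k (Set.range x)
  have hx (q : Fin 3) : x q ∈ W :=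
    (le_sup_right : _ ≤ W) (Submodule.subset_span ⟨q, rfl⟩)
  refine Submodule.span_le.2 ?_
  rintro _ ⟨e, ⟨-, hn⟩, rfl⟩
  have : orderedMonomial x e ∈ W ^ (∑ i, e i) := by
    rw [Fin.sum_univ_three, pow_add, pow_add]
    exact Submodule.mul_mem_mul (Submodule.mul_mem_mul (Submodule.pow_mem_pow _ (hx 0) _)
      (Submodule.pow_mem_pow _ (hx 1) _)) (Submodule.pow_mem_pow _ (hx 2) _)
  exact pow_le_pow_right₀ (le_sup_left : 1 ≤ W) hn this

theorem finrank_pow_le_ncard (h : IsStraightening k x S) (h0 : 0 ∈ S) {W : Submodule k A} {d : ℕ}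
    (hW : W ≤ monomialFiltration k x S d) (n : ℕ) :
    Module.finrank k ((1 ⊔ W) ^ n : Submodule k A) ≤ (degreeLE S (d * n)).ncard := by
  have := Module.Finite.of_fg (monomialFiltration_fg k x S (d * n))
  exact (Submodule.finrank_mono (h.pow_le h0 hW n)).trans (finrank_monomialFiltration_le x S _)

theorem ncard_le_finrank_pow (hli : LinearIndependent k fun e : S => orderedMonomial x e) (n : ℕ) :
    (degreeLE S n).ncard ≤
      Module.finrank k ((1 ⊔ Submodule.span k (Set.range x)) ^ n : Submodule k A) := by
  have hone : (1 : Submodule k A).FG :=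
    Submodule.one_eq_span (R := k) (A := A) ▸ Submodule.fg_span_singleton 1
  have := Module.Finite.of_fg ((hone.sup (Submodule.fg_span (Set.finite_range x))).pow n)
  rw [← finrank_monomialFiltration hli]
  exact Submodule.finrank_mono (monomialFiltration_le_pow n)

theorem IsStraightening.gkDim_eq (h : IsStraightening k x S) (h0 : 0 ∈ S)
    (hx : Algebra.adjoin k (Set.range x) = ⊤)
    (hli : LinearIndependent k fun e : S => orderedMonomial x e) {g : ℕ} {c C : ℝ}
    (hc : 0 < c) (hlow : ∀ n : ℕ, c * (n : ℝ) ^ g ≤ (degreeLE S n).ncard)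
    (hup : ∀ n : ℕ, ((degreeLE S n).ncard : ℝ) ≤ C * (n + 1 : ℝ) ^ g) :
    gkDim k A = g := by
  refine le_antisymm (gkDim_le fun W hW => ?_) (le_gkDim (W := Submodule.span k (Set.range x))
    (Submodule.fg_span (Set.finite_range x)) hc fun n => (hlow n).trans ?_)
  · obtain ⟨d, hWd⟩ := h.exists_le_monomialFiltration h0 hx hW
    have hC : 0 ≤ C := by simpa using (Nat.cast_nonneg _).trans (hup 0)
    refine ⟨C * (d + 1 : ℝ) ^ g, fun n hn => ?_⟩
    have hn1 : (1 : ℝ) ≤ n := by exact_mod_cast hn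
    calc (Module.finrank k ((1 ⊔ W) ^ n : Submodule k A) : ℝ)
        ≤ (degreeLE S (d * n)).ncard := mod_cast finrank_pow_le_ncard h h0 hWd n
      _ ≤ C * ((d * n : ℕ) + 1 : ℝ) ^ g := hup _
      _ ≤ C * ((d + 1) * n : ℝ) ^ g := by
        gcongr
        push_cast
        linarith
      _ = C * (d + 1 : ℝ) ^ g * (n : ℝ) ^ g := by rw [mul_pow, mul_assoc]
  · exact_mod_cast ncard_le_finrank_pow hli n

theorem ncard_degreeLE_le {n : ℕ} {s : Fin 3 → Finset ℕ}
    (h : ∀ e ∈ degreeLE S n, ∀ i, e i ∈ s i) : (degreeLE S n).ncard ≤ ∏ i, (s i).card := by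
  have hsub : degreeLE S n ⊆ Fintype.piFinset s := fun e he => by simpa using h e he
  refine (Set.ncard_le_ncard hsub (Finset.finite_toSet _)).trans ?_
  rw [Set.ncard_coe_finset, Fintype.card_piFinset]

theorem le_ncard_degreeLE {n : ℕ} {s : Fin 3 → Finset ℕ}
    (h : ∀ e : Fin 3 → ℕ, (∀ i, e i ∈ s i) → e ∈ degreeLE S n) :
    ∏ i, (s i).card ≤ (degreeLE S n).ncard := by
  have hsub : (Fintype.piFinset s : Set (Fin 3 → ℕ)) ⊆ degreeLE S n := fun e he =>
    h e (by simpa using he)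
  rw [← Fintype.card_piFinset, ← Set.ncard_coe_finset]
  exact Set.ncard_le_ncard hsub (finite_degreeLE S n)

theorem ncard_degreeLE_B₃_le (n : ℕ) : (degreeLE B₃ n).ncard ≤ (n + 1) ^ 3 := by
  refine (ncard_degreeLE_le (s := fun _ => Finset.range (n + 1)) fun e he i => ?_).trans (by simp)
  exact Finset.mem_range_succ_iff.2 (le_of_mem_degreeLE he i)

theorem le_ncard_degreeLE_B₃ (n : ℕ) : (n / 3 + 1) ^ 3 ≤ (degreeLE B₃ n).ncard := by
  refine le_trans (by simp) (le_ncard_degreeLE (s := fun _ => Finset.range (n / 3 + 1))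
    fun e he => ⟨trivial, ?_⟩)
  calc ∑ i, e i ≤ ∑ _ : Fin 3, n / 3 :=
        Finset.sum_le_sum fun i _ => Finset.mem_range_succ_iff.1 (he i)
    _ ≤ n := by simpa using Nat.mul_div_le n 3

theorem ncard_degreeLE_B₁_le (n : ℕ) : (degreeLE B₁ n).ncard ≤ 4 * (n + 1) := by
  refine (ncard_degreeLE_le (s := ![Finset.range 2, Finset.range 2, Finset.range (n + 1)])
    fun e he => ?_).trans (by simp [Fin.prod_univ_three])
  exact Fin.forall_fin_succ.2 ⟨by simpa using he.1.1, Fin.forall_fin_two.2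
    ⟨by simpa using he.1.2, by simpa using Nat.lt_succ_of_le (le_of_mem_degreeLE he 2)⟩⟩

theorem le_ncard_degreeLE_B₁ (n : ℕ) : n + 1 ≤ (degreeLE B₁ n).ncard := by
  refine le_trans (by simp [Fin.prod_univ_three])
    (le_ncard_degreeLE (s := ![{0}, {0}, Finset.range (n + 1)]) fun e he => ?_)
  obtain ⟨h0, h1, h2⟩ : e 0 = 0 ∧ e 1 = 0 ∧ e 2 ≤ n := by
    simpa [Fin.forall_fin_succ, Nat.lt_succ_iff] using he
  exact ⟨by simp [B₁, h0, h1], by simpa [Fin.sum_univ_three, h0, h1]⟩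

theorem ncard_degreeLE_B₀_le (n : ℕ) : (degreeLE B₀ n).ncard ≤ 8 :=
  ncard_degreeLE_le (s := fun _ => Finset.range 2) fun _ he i => Finset.mem_range.2 (he.1 i)

theorem one_le_ncard_degreeLE (h0 : 0 ∈ S) (n : ℕ) : 1 ≤ (degreeLE S n).ncard :=
  (Set.ncard_pos (finite_degreeLE S n)).2 ⟨0, h0, by simp⟩

theorem gkDim_eq_three (h : IsStraightening k x B₃) (hx : Algebra.adjoin k (Set.range x) = ⊤)
    (hli : LinearIndependent k fun e : B₃ => orderedMonomial x e) : gkDim k A = 3 := by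
  refine (h.gkDim_eq trivial hx hli (g := 3) (c := 1 / 27) (C := 1) (by norm_num)
    (fun n => ?_) fun n => ?_).trans (by norm_num)
  · have hdiv : (n : ℝ) ≤ 3 * ((n / 3 + 1 : ℕ) : ℝ) := by exact_mod_cast (by omega)
    calc 1 / 27 * (n : ℝ) ^ 3 ≤ 1 / 27 * (3 * ((n / 3 + 1 : ℕ) : ℝ)) ^ 3 := by gcongr
      _ = ((n / 3 + 1 : ℕ) : ℝ) ^ 3 := by ring
      _ ≤ (degreeLE B₃ n).ncard := mod_cast le_ncard_degreeLE_B₃ n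
  · rw [one_mul]
    exact_mod_cast ncard_degreeLE_B₃_le n

theorem gkDim_eq_one (h : IsStraightening k x B₁) (hx : Algebra.adjoin k (Set.range x) = ⊤)
    (hli : LinearIndependent k fun e : B₁ => orderedMonomial x e) : gkDim k A = 1 := by
  refine (h.gkDim_eq (by simp [B₁]) hx hli (g := 1) (c := 1) (C := 4) one_pos
    (fun n => ?_) fun n => ?_).trans (by norm_num)
  · rw [one_mul, pow_one]
    exact_mod_cast (Nat.le_succ n).trans (le_ncard_degreeLE_B₁ n)
  · rw [pow_one]
    exact_mod_cast ncard_degreeLE_B₁_le n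

theorem gkDim_eq_zero (h : IsStraightening k x B₀) (hx : Algebra.adjoin k (Set.range x) = ⊤)
    (hli : LinearIndependent k fun e : B₀ => orderedMonomial x e) : gkDim k A = 0 := by
  have h0 : 0 ∈ B₀ := by simp [B₀]
  refine (h.gkDim_eq h0 hx hli (g := 0) (c := 1) (C := 8) one_pos
    (fun n => ?_) fun n => ?_).trans (by norm_num)
  · rw [pow_zero, mul_one]
    exact_mod_cast one_le_ncard_degreeLE h0 n
  · rw [pow_zero, mul_one]
    exact_mod_cast ncard_degreeLE_B₀_le n

theorem finrank_eq_eight (hli : LinearIndependent k fun e : B₀ => orderedMonomial x e)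
    (hspan : Submodule.span k (Set.range fun e : B₀ => orderedMonomial x e) = ⊤) :
    Module.finrank k A = 8 := by
  have hB : B₀ = (Fintype.piFinset fun _ : Fin 3 => Finset.range 2 : Set (Fin 3 → ℕ)) := by
    ext e
    simp [B₀]
  rw [Module.finrank_eq_nat_card_basis (Module.Basis.mk hli hspan.ge), Nat.card_coe_set_eq, hB,
    Set.ncard_coe_finset, Fintype.card_piFinset]
  simp

end Growth

section Classification

variable {k : Type*} [Field k] {a b p : k}

theorem adjoin_range_mk_gen (B : Braiding k (Fin 3)) :
    Algebra.adjoin k (Set.range ((nicholsIdeal B).ringCon.mkₐ k ∘ gen k)) = ⊤ :=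
  adjoin_range_comp_gen (RingCon.mkₐ_surjective (α := k) _)

theorem nicholsAlgebra_braiding14_one [CharZero k] {ht : (1 : k) ≠ 0} :
    nicholsIdeal (braiding14 1 a b p ht) = TwoSidedIdeal.span (relSym a b) ∧
      IsMonomialBasis (braiding14 1 a b p ht) B₃ ∧
      gkDim k (NicholsAlgebra (braiding14 1 a b p ht)) = 3 := by
  have hG : relSym a b ⊆ nicholsIdeal (braiding14 1 a b p ht) := relSym_subset_nicholsIdeal
  have straightening {I : TwoSidedIdeal (T k (Fin 3))} (hI : relSym a b ⊆ I) :
      IsStraightening k (I.ringCon.mkₐ k ∘ gen k) B₃ :=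
    isStraightening_of_relSym fun r hr => mk_eq_zero_iff.2 (hI hr)
  have hind := linearIndependent_orderedMonomial (S := B₃)
    (isSeparating_der_two_pow (t := 1) (a := a) (b := b) (p := p) (ht := ht))
    (fun e _ => qDescFactorial_one_self_ne_zero (e 0))
    (fun e _ => qDescFactorial_one_self_ne_zero (e 1))
    (fun e _ => by
      rw [counit_der_two_pow_gen_two_pow]
      exact qDescFactorial_one_self_ne_zero (e 2))
  have h0 : (0 : Fin 3 → ℕ) ∈ B₃ := Set.mem_univ 0
  have hB := isMonomialBasis_of_isStraightening h0 (straightening hG) hind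
  exact ⟨nicholsIdeal_eq_span hG h0 (straightening TwoSidedIdeal.subset_span) hind, hB,
    gkDim_eq_three (straightening hG) (adjoin_range_mk_gen _) hB.1⟩

theorem nicholsAlgebra_braiding14_neg_one_of_ne_zero [CharZero k] {ht : (-1 : k) ≠ 0}
    (hp : p ≠ 0) :
    nicholsIdeal (braiding14 (-1) a b p ht) = TwoSidedIdeal.span (relExt a b) ∧
      IsMonomialBasis (braiding14 (-1) a b p ht) B₁ ∧
      gkDim k (NicholsAlgebra (braiding14 (-1) a b p ht)) = 1 := by
  have hG : relExt a b ⊆ nicholsIdeal (braiding14 (-1) a b p ht) := relExt_subset_nicholsIdeal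
  have straightening {I : TwoSidedIdeal (T k (Fin 3))} (hI : relExt a b ⊆ I) :
      IsStraightening k (I.ringCon.mkₐ k ∘ gen k) B₁ :=
    isStraightening_of_relExt fun r hr => mk_eq_zero_iff.2 (hI hr)
  have hind := linearIndependent_orderedMonomial (S := B₁)
    (isSeparating_derOneZero (a := a) (b := b) (p := p) (ht := ht))
    (fun e he => qDescFactorial_self_ne_zero_of_lt_two (-1) he.1)
    (fun e he => qDescFactorial_self_ne_zero_of_lt_two (-1) he.2)
    (fun e _ => counit_derOneZero_gen_two_pow_ne_zero hp (e 2))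
  have h0 : (0 : Fin 3 → ℕ) ∈ B₁ := by simp [B₁]
  have hB := isMonomialBasis_of_isStraightening h0 (straightening hG) hind
  exact ⟨nicholsIdeal_eq_span hG h0 (straightening TwoSidedIdeal.subset_span) hind, hB,
    gkDim_eq_one (straightening hG) (adjoin_range_mk_gen _) hB.1⟩

theorem nicholsAlgebra_braiding14_neg_one_zero {ht : (-1 : k) ≠ 0} :
    nicholsIdeal (braiding14 (-1) a b 0 ht) = TwoSidedIdeal.span (relFin a b) ∧
      IsMonomialBasis (braiding14 (-1) a b 0 ht) B₀ ∧
      gkDim k (NicholsAlgebra (braiding14 (-1) a b 0 ht)) = 0 ∧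
      Module.finrank k (NicholsAlgebra (braiding14 (-1) a b 0 ht)) = 8 := by
  have hG : relFin a b ⊆ nicholsIdeal (braiding14 (-1) a b 0 ht) := relFin_subset_nicholsIdeal
  have straightening {I : TwoSidedIdeal (T k (Fin 3))} (hI : relFin a b ⊆ I) :
      IsStraightening k (I.ringCon.mkₐ k ∘ gen k) B₀ :=
    isStraightening_of_relFin fun r hr => mk_eq_zero_iff.2 (hI hr)
  have hind := linearIndependent_orderedMonomial (S := B₀)
    (isSeparating_der_two_pow (t := -1) (a := a) (b := b) (p := 0) (ht := ht))
    (fun e he => qDescFactorial_self_ne_zero_of_lt_two (-1) (he 0))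
    (fun e he => qDescFactorial_self_ne_zero_of_lt_two (-1) (he 1))
    (fun e he => by
      rw [counit_der_two_pow_gen_two_pow]
      exact qDescFactorial_self_ne_zero_of_lt_two (-1) (he 2))
  have h0 : (0 : Fin 3 → ℕ) ∈ B₀ := by simp [B₀]
  have hB := isMonomialBasis_of_isStraightening h0 (straightening hG) hind
  exact ⟨nicholsIdeal_eq_span hG h0 (straightening TwoSidedIdeal.subset_span) hind, hB,
    gkDim_eq_zero (straightening hG) (adjoin_range_mk_gen _) hB.1,
    finrank_eq_eight (x := (nicholsIdeal _).ringCon.mkₐ k ∘ gen k) hB.1 hB.2⟩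

end Classification

end BraidedRank

open BraidedRank in
theorem proposition3p9_general {k : Type*} [Field k] [CharZero k] (t a b p : k) (ht : t ≠ 0) :
    let V : Braiding k (Fin 3) := braiding14 t a b p ht
    let x₁ : T k (Fin 3) := FreeAlgebra.ι k 0
    let x₂ : T k (Fin 3) := FreeAlgebra.ι k 1
    let x₃ : T k (Fin 3) := FreeAlgebra.ι k 2
    (t ^ 2 ≠ 1 → quadraticRelations V = ⊥) ∧
    (t = 1 →
      nicholsIdeal V = TwoSidedIdeal.span
        {x₂ * x₁ - x₁ * x₂,
         x₃ * x₁ - x₁ * x₃ - a • x₁ ^ 2,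
         x₃ * x₂ - x₂ * x₃ + (a - 2 * b) • (x₁ * x₂)} ∧
      IsMonomialBasis V B₃ ∧
      gkDim k (NicholsAlgebra V) = 3) ∧
    (t = -1 → p ≠ 0 →
      nicholsIdeal V = TwoSidedIdeal.span
        {x₂ * x₁ + x₁ * x₂,
         x₃ * x₁ + x₁ * x₃,
         x₃ * x₂ + x₂ * x₃ + (a - 2 * b) • (x₁ * x₂),
         x₁ ^ 2,
         x₂ ^ 2} ∧
      IsMonomialBasis V B₁ ∧
      gkDim k (NicholsAlgebra V) = 1) ∧
    (t = -1 → p = 0 →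
      nicholsIdeal V = TwoSidedIdeal.span
        {x₂ * x₁ + x₁ * x₂,
         x₃ * x₁ + x₁ * x₃,
         x₃ * x₂ + x₂ * x₃ + (a - 2 * b) • (x₁ * x₂),
         x₁ ^ 2,
         x₂ ^ 2,
         x₃ ^ 2 - b • (x₁ * x₃)} ∧
      IsMonomialBasis V B₀ ∧
      gkDim k (NicholsAlgebra V) = 0 ∧
      Module.finrank k (NicholsAlgebra V) = 8) := by
  intro V x₁ x₂ x₃
  refine ⟨fun h => quadraticRelations_eq_bot fun f hf => eq_zero_of_inKer_braiding14 h hf,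
    ?_, ?_, ?_⟩
  · rintro rfl
    exact nicholsAlgebra_braiding14_one
  · rintro rfl hp
    exact nicholsAlgebra_braiding14_neg_one_of_ne_zero hp
  · rintro rfl rfl
    exact nicholsAlgebra_braiding14_neg_one_zero

open BraidedRank in
theorem proposition3p9 {k : Type*} [Field k] [IsAlgClosed k] [CharZero k]
    (t a b p : k) (ht : t ≠ 0) :
    let V : Braiding k (Fin 3) := braiding14 t a b p ht
    let x₁ : T k (Fin 3) := FreeAlgebra.ι k 0
    let x₂ : T k (Fin 3) := FreeAlgebra.ι k 1
    let x₃ : T k (Fin 3) := FreeAlgebra.ι k 2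
    (t ^ 2 ≠ 1 → quadraticRelations V = ⊥) ∧
    (t = 1 →
      nicholsIdeal V = TwoSidedIdeal.span
        {x₂ * x₁ - x₁ * x₂,
         x₃ * x₁ - x₁ * x₃ - a • x₁ ^ 2,
         x₃ * x₂ - x₂ * x₃ + (a - 2 * b) • (x₁ * x₂)} ∧
      IsMonomialBasis V B₃ ∧
      gkDim k (NicholsAlgebra V) = 3) ∧
    (t = -1 → p ≠ 0 →
      nicholsIdeal V = TwoSidedIdeal.span
        {x₂ * x₁ + x₁ * x₂,
         x₃ * x₁ + x₁ * x₃,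
         x₃ * x₂ + x₂ * x₃ + (a - 2 * b) • (x₁ * x₂),
         x₁ ^ 2,
         x₂ ^ 2} ∧
      IsMonomialBasis V B₁ ∧
      gkDim k (NicholsAlgebra V) = 1) ∧
    (t = -1 → p = 0 →
      nicholsIdeal V = TwoSidedIdeal.span
        {x₂ * x₁ + x₁ * x₂,
         x₃ * x₁ + x₁ * x₃,
         x₃ * x₂ + x₂ * x₃ + (a - 2 * b) • (x₁ * x₂),
         x₁ ^ 2,
         x₂ ^ 2,
         x₃ ^ 2 - b • (x₁ * x₃)} ∧
      IsMonomialBasis V B₀ ∧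
      gkDim k (NicholsAlgebra V) = 0 ∧
      Module.finrank k (NicholsAlgebra V) = 8) := proposition3p9_general t a b p ht
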